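/- Let $K$ be a field of characteristic $0$, and let $p_1,p_2,p_3\ge 3$ be integers. For $p\ge 3$ let $v_p(X)\in\mathbb Q[X]$ be the minimal polynomial of $4\cos^2(\pi/p)$ (its roots are the numbers $4\cos^2(k\pi/p)$, $\gcd(k,p)=1$), and let $\alpha_i\in K$ be a root of $v_{p_i}$ ($i=1,2,3$). For a $4\times 4$ Cartan matrix $C=(c_{ij})$ over $K$ as below, let $M=K^4$ with canonical basis $a_1,\dots,a_4$, let $s_i\in GL(M)$ be the reflection $s_i(a_j)=a_j-c_{ij}a_i$, let $R:W\to GL(M)$ be the resulting reflection representation of the Coxeter group $W$ of the given labelled graph (sending the $i$-th Coxeter generator to $s_i$), and put $G=\mathrm{Im}\,R=\langle s_1,s_2,s_3,s_4\rangle$, $\Delta(G)=\det C$, $H=\bigcap_i\ker(s_i-1)$, $n_0=\dim H$. Let $N(G)$ be the group of those $g\in G$ that act trivially on $M/H$. (I) Let the graph be the path $s_1 - s_2 - s_3 - s_4$ with successive labels $p_1,p_2,p_3$, and $$C=\begin{pmatrix}2&-\alpha_1&0&0\\-1&2&-\alpha_2&0\\0&-1&2&-\alpha_3\\0&0&-1&2\end{pmatrix}.$$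 Then $\Delta(G)=0$ if and only if $p_1=p_3=4$, $p_2=3$, $\alpha_1=\alpha_3=2$, $\alpha_2=1$. In that case $n_0=1$, $H$ is spanned by $b=a_1+a_2+a_3+\frac12a_4$, and $(G,\{s_1,s_2,s_3,s_4\})$ is a Coxeter system of type $\tilde C_3$; in particular $G\simeq W(\tilde C_3)$. (II) Let the graph be the star with centre $s_1$ and edges $s_1 - s_2$, $s_1 - s_3$, $s_1 - s_4$ labelled $p_1,p_2,p_3$, and $$C=\begin{pmatrix}2&-\alpha_1&-\alpha_2&-\alpha_3\\-1&2&0&0\\-1&0&2&0\\-1&0&0&2\end{pmatrix}.$$ Then $\Delta(G)=0$ if and only if, after a permutation of the three branches, one of the following holds: (i) $p_1=p_2=3$, $p_3=4$, $\alpha_1=\alpha_2=1$, $\alpha_3=2$; (ii) $p_1=p_2=5$, $p_3=3$, $\alpha_1=\tau$, $\alpha_2=3-\tau$, $\alpha_3=1$, where $\tau\in K$ and $\tau^2-3\tau+1=0$. Whenever $\Delta(G)=0$ one has $n_0=1$ and $H$ is spanned by $b=a_1+\frac12(a_2+a_3+a_4)$. In case (i), $(G,\{s_1,s_2,s_3,s_4\})$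 is a Coxeter system of type $\tilde B_3$; in particular $G\simeq W(\tilde B_3)$. In case (ii), $G$ is isomorphic to the affine reflection group $W(\tilde H_3)$ of type $H_3$, that is, the group of affine transformations of Euclidean $3$-space generated by the orthogonal reflections in all planes $\{x:\langle x,r\rangle=k\}$, where $r$ runs through the root system of type $H_3$ (all roots of norm $\langle r,r\rangle=2$) and $k$ through $\mathbb Z$; the isomorphism can be chosen so that each $s_i$ is mapped to one of these affine reflections and so that $N(G)$ is exactly the set of the elements mapped to translations. -/

import Mathlib

noncomputable section

namespace ReflRep

open Polynomial

/-- The polynomial `v_p`: the monic polynomial over `ℚ` whose roots are the numbers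
`4 cos² (k π / p)` with `k` prime to `p` (a full Galois orbit), written as the minimal polynomial
of `4 cos² (π / p)`. For example `v_3 = X - 1`, `v_4 = X - 2`, `v_5 = X² - 3 X + 1`. -/
def vPoly (p : ℕ) : ℚ[X] := minpoly ℚ (4 * Real.cos (Real.pi / p) ^ 2 : ℝ)

variable {ι : Type*} {K : Type*} [Field K]

/-- `C` is the Cartan matrix of a reflection representation of the Coxeter group with Coxeter
matrix `M`: the diagonal entries are `2`, the entries `C i j` with `M i j = 2` vanish, and
`C i j * C j i` is a root of `v_{M i j}` whenever `M i j ≥ 3` (nothing is asked when `M i j = 0`,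
which stands for `∞`). -/
structure IsCartan [CharZero K] (M : CoxeterMatrix ι) (C : Matrix ι ι K) : Prop where
  diag : ∀ i, C i i = 2
  comm : ∀ i j, M i j = 2 → C i j = 0
  root : ∀ i j, 3 ≤ M i j → aeval (C i j * C j i) (vPoly (M i j)) = 0

variable [Fintype ι] [DecidableEq ι]

/-- The linear form `x ↦ ∑ j, C i j * x j`. -/
def rowForm (C : Matrix ι ι K) (i : ι) : Module.Dual K (ι → K) :=
  (LinearMap.proj i).comp C.mulVecLin

theorem rowForm_single (C : Matrix ι ι K) (i j : ι) :
    rowForm C i (Pi.single j 1) = C i j := by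
  simp [rowForm]

variable [CharZero K]

/-- The reflection `s_i` of `K^ι`, whose canonical basis is denoted by `a`:
`s_i (a_j) = a_j - C i j • a_i`. -/
def simpleReflection {M : CoxeterMatrix ι} {C : Matrix ι ι K} (h : IsCartan M C) (i : ι) :
    (ι → K) ≃ₗ[K] (ι → K) :=
  Module.reflection (x := Pi.single i 1) (f := rowForm C i)
    ((rowForm_single C i i).trans (h.diag i))

theorem simpleReflection_single {M : CoxeterMatrix ι} {C : Matrix ι ι K} (h : IsCartan M C)
    (i j : ι) : simpleReflection h i (Pi.single j 1) =
      Pi.single j 1 - C i j • (Pi.single i 1 : ι → K) := by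
  rw [simpleReflection, Module.reflection_apply, rowForm_single]

open Chebyshev in
theorem transfer {m : ℕ} {x : K} (hx : aeval x (vPoly m) = 0) (a b c : ℤ)
    (h : (S ℝ a).eval (2 * Real.cos (2 * (Real.pi / m))) *
      ((S ℝ b).eval (2 * Real.cos (2 * (Real.pi / m))) +
        (S ℝ c).eval (2 * Real.cos (2 * (Real.pi / m)))) = 0) :
    (S K a).eval (x - 2) * ((S K b).eval (x - 2) + (S K c).eval (x - 2)) = 0 := by
  have key : vPoly m ∣ (S ℚ a * (S ℚ b + S ℚ c)).comp (X - Polynomial.C 2) := by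
    apply minpoly.dvd
    have e : (4 * Real.cos (Real.pi / m) ^ 2 : ℝ) - 2 = 2 * Real.cos (2 * (Real.pi / m)) := by
      rw [Real.cos_two_mul]; ring
    simpa [aeval_comp, aeval_S, e] using h
  obtain ⟨q, hq⟩ := key
  have := congrArg (aeval x) hq
  rw [map_mul, hx, zero_mul] at this
  simpa [aeval_comp, aeval_S] using this

open Chebyshev in
theorem isLiftable {M : CoxeterMatrix ι} {C : Matrix ι ι K} (h : IsCartan M C) :
    M.IsLiftable (simpleReflection h) := by
  intro i j
  by_cases hij : i = j
  · subst hij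
    rw [M.diagonal, pow_one]
    ext1 x
    exact Module.involutive_reflection _ x
  have h1 := M.off_diagonal i j hij
  rcases Nat.lt_or_ge (M i j) 3 with h3 | h3
  · obtain h0 | h2 : M i j = 0 ∨ M i j = 2 := by
      have : M i j ≠ 1 := h1
      omega
    · rw [h0, pow_zero]
    · have hc := h.comm i j h2
      have hc' := h.comm j i ((M.symmetric j i).trans h2)
      rw [h2, pow_two]
      apply LinearEquiv.toLinearMap_injective
      refine LinearMap.pi_ext' fun k => LinearMap.ext_ring ?_
      simp [simpleReflection_single, map_sub, map_smul, hc, hc', h.diag]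
      module
  · have hr := h.root i j h3
    set m := M i j with hm
    have hm0 : (m : ℝ) ≠ 0 := by positivity
    have hS : ∀ n : ℤ, (S ℝ n).eval (2 * Real.cos (2 * (Real.pi / m))) *
        Real.sin (2 * (Real.pi / m)) = Real.sin ((n + 1) * (2 * (Real.pi / m))) :=
      fun n => S_two_mul_real_cos _ n
    have hsin : Real.sin (2 * (Real.pi / m)) ≠ 0 := by
      apply ne_of_gt
      apply Real.sin_pos_of_pos_of_lt_pi
      · positivity
      · have : (3 : ℝ) ≤ m := by exact_mod_cast h3
        rw [← mul_div_assoc, div_lt_iff₀ (by positivity)]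
        nlinarith [Real.pi_pos]
    have one : ∀ a : ℤ, 2 * (a + 1) = m →
        (S ℝ a).eval (2 * Real.cos (2 * (Real.pi / m))) = 0 := by
      intro a ha
      have ha' : 2 * ((a : ℝ) + 1) = m := by exact_mod_cast ha
      apply (mul_eq_zero_iff_right hsin).mp
      rw [hS, show ((a : ℝ) + 1) * (2 * (Real.pi / m)) = Real.pi by
        rw [← ha'] at hm0 ⊢
        have hm1 : (a : ℝ) + 1 ≠ 0 := fun h => hm0 (by rw [h, mul_zero])
        field_simp]
      exact Real.sin_pi
    have two : ∀ a : ℤ, 2 * a + 1 = m →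
        (S ℝ a).eval (2 * Real.cos (2 * (Real.pi / m))) +
        (S ℝ (a - 1)).eval (2 * Real.cos (2 * (Real.pi / m))) = 0 := by
      intro a ha
      have ha' : 2 * (a : ℝ) + 1 = m := by exact_mod_cast ha
      apply (mul_eq_zero_iff_right hsin).mp
      rw [add_mul, hS, hS]
      have e1 : ((a : ℝ) + 1) * (2 * (Real.pi / m)) = Real.pi + Real.pi / m := by
        field_simp; linear_combination ha'
      have e2 : (((a - 1 : ℤ) : ℝ) + 1) * (2 * (Real.pi / m)) = Real.pi - Real.pi / m := by
        push_cast; field_simp; linear_combination ha'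
      rw [e1, e2, Real.sin_add, Real.sin_sub, Real.sin_pi, Real.cos_pi]
      ring
    apply LinearEquiv.toLinearMap_injective
    have hform := Module.reflection_mul_reflection_pow
      ((rowForm_single C i i).trans (h.diag i)) ((rowForm_single C j j).trans (h.diag j)) m
      (C i j * C j i - 2) (by rw [rowForm_single, rowForm_single])
    have hA := transfer hr (((m : ℤ) - 2) / 2) (((m : ℤ) - 1) / 2) (((m : ℤ) - 3) / 2) (by
      rcases Nat.even_or_odd' m with ⟨k, hk | hk⟩
      · rw [one _ (by omega), zero_mul]
      · rw [show ((m : ℤ) - 3) / 2 = ((m : ℤ) - 1) / 2 - 1 by omega, two _ (by omega), mul_zero])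
    have hB := transfer hr (((m : ℤ) - 1) / 2) ((m : ℤ) / 2) (((m : ℤ) - 2) / 2) (by
      rcases Nat.even_or_odd' m with ⟨k, hk | hk⟩
      · rw [one _ (by omega), zero_mul]
      · rw [show ((m : ℤ) - 2) / 2 = ((m : ℤ) / 2) - 1 by omega, two _ (by omega), mul_zero])
    rw [hA, hB, zero_smul, zero_smul, add_zero, add_zero] at hform
    exact hform

/-- The reflection representation `R : W → GL(K^ι)` of the Coxeter group `W` with Coxeter matrix
`M` that is attached to the Cartan matrix `C`. -/
def reflRep {M : CoxeterMatrix ι} {C : Matrix ι ι K} (h : IsCartan M C) :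
    M.Group →* ((ι → K) ≃ₗ[K] (ι → K)) :=
  M.toCoxeterSystem.lift ⟨simpleReflection h, isLiftable h⟩

theorem reflRep_simple {M : CoxeterMatrix ι} {C : Matrix ι ι K} (h : IsCartan M C) (i : ι) :
    reflRep h (M.simple i) = simpleReflection h i :=
  M.toCoxeterSystem.lift_apply_simple (isLiftable h) i

/-- The reflection group `G = Im R`. -/
def reflGroup {M : CoxeterMatrix ι} {C : Matrix ι ι K} (h : IsCartan M C) :
    Subgroup ((ι → K) ≃ₗ[K] (ι → K)) :=
  (reflRep h).range

/-- The generator `s_i` as an element of `G`. -/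
def gen {M : CoxeterMatrix ι} {C : Matrix ι ι K} (h : IsCartan M C) (i : ι) : reflGroup h :=
  ⟨simpleReflection h i, M.simple i, reflRep_simple h i⟩

/-- `H`, the intersection of the hyperplanes `H(s_i)` of fixed points of the `s_i`. -/
def fixedSpace {M : CoxeterMatrix ι} {C : Matrix ι ι K} (h : IsCartan M C) :
    Submodule K (ι → K) :=
  ⨅ i, LinearMap.ker ((simpleReflection h i).toLinearMap - LinearMap.id)

/-- `g` is a translation of the reflection group: it acts trivially on `K^ι ⧸ H`. The elements
of `G` with this property form the translation subgroup `N(G)`. -/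
def IsTranslation {M : CoxeterMatrix ι} {C : Matrix ι ι K} (h : IsCartan M C)
    (g : (ι → K) ≃ₗ[K] (ι → K)) : Prop :=
  ∀ x, g x - x ∈ fixedSpace h

/-- The discriminant `Δ(G)`. -/
def discr {M : CoxeterMatrix ι} {C : Matrix ι ι K} (_h : IsCartan M C) : K := C.det

/-! ### The two rank four diagrams -/

/-- The path with successive edge labels `p 0, p 1, p 2`. -/
def pathCoxeter (p : Fin 3 → ℕ) (hp : ∀ i, 3 ≤ p i) : CoxeterMatrix (Fin 4) where
  M := !![1, p 0, 2, 2;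
          p 0, 1, p 1, 2;
          2, p 1, 1, p 2;
          2, 2, p 2, 1]
  isSymm := by ext i j; fin_cases i <;> fin_cases j <;> rfl
  diagonal i := by fin_cases i <;> rfl
  off_diagonal i j := by
    have h0 := hp 0
    have h1 := hp 1
    have h2 := hp 2
    fin_cases i <;> fin_cases j <;> simp <;> omega

/-- The star with centre `0`, the edge from the centre to the leaf `k + 1` being labelled `p k`. -/
def starCoxeter (p : Fin 3 → ℕ) (hp : ∀ i, 3 ≤ p i) : CoxeterMatrix (Fin 4) where
  M := !![1, p 0, p 1, p 2;
          p 0, 1, 2, 2;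
          p 1, 2, 1, 2;
          p 2, 2, 2, 1]
  isSymm := by ext i j; fin_cases i <;> fin_cases j <;> rfl
  diagonal i := by fin_cases i <;> rfl
  off_diagonal i j := by
    have h0 := hp 0
    have h1 := hp 1
    have h2 := hp 2
    fin_cases i <;> fin_cases j <;> simp <;> omega

/-- The Cartan matrix for the path. -/
def pathCartan (α : Fin 3 → K) : Matrix (Fin 4) (Fin 4) K :=
  !![2, -α 0, 0, 0;
     -1, 2, -α 1, 0;
     0, -1, 2, -α 2;
     0, 0, -1, 2]

/-- The Cartan matrix for the star. -/
def starCartan (α : Fin 3 → K) : Matrix (Fin 4) (Fin 4) K :=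
  !![2, -α 0, -α 1, -α 2;
     -1, 2, 0, 0;
     -1, 0, 2, 0;
     -1, 0, 0, 2]

theorem path_isCartan {p : Fin 3 → ℕ} (hp : ∀ i, 3 ≤ p i) {α : Fin 3 → K}
    (hα : ∀ i, aeval (α i) (vPoly (p i)) = 0) :
    IsCartan (pathCoxeter p hp) (pathCartan α) where
  diag i := by fin_cases i <;> rfl
  comm i j := by
    have h0 := hp 0
    have h1 := hp 1
    have h2 := hp 2
    fin_cases i <;> fin_cases j <;> simp [pathCoxeter, pathCartan] <;> omega
  root i j := by
    have h0 := hα 0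
    have h1 := hα 1
    have h2 := hα 2
    fin_cases i <;> fin_cases j <;> simp_all [pathCoxeter, pathCartan]

theorem star_isCartan {p : Fin 3 → ℕ} (hp : ∀ i, 3 ≤ p i) {α : Fin 3 → K}
    (hα : ∀ i, aeval (α i) (vPoly (p i)) = 0) :
    IsCartan (starCoxeter p hp) (starCartan α) where
  diag i := by fin_cases i <;> rfl
  comm i j := by
    have h0 := hp 0
    have h1 := hp 1
    have h2 := hp 2
    fin_cases i <;> fin_cases j <;> simp [starCoxeter, starCartan] <;> omega
  root i j := by
    have h0 := hα 0
    have h1 := hα 1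
    have h2 := hα 2
    fin_cases i <;> fin_cases j <;> simp_all [starCoxeter, starCartan]

/-! ### Affine groups -/

/-- The Coxeter matrix of the affine Weyl group of type `C̃₃`:
```
    4       4
  o --- o --- o --- o
```
-/
def affineC₃ : CoxeterMatrix (Fin 4) where
  M := !![1, 4, 2, 2;
          4, 1, 3, 2;
          2, 3, 1, 4;
          2, 2, 4, 1]
  isSymm := by ext i j; fin_cases i <;> fin_cases j <;> rfl
  diagonal i := by fin_cases i <;> rfl
  off_diagonal i j := by fin_cases i <;> fin_cases j <;> simp

/-- The Coxeter matrix of the affine Weyl group of type `B̃₃`: a star with centre `0` whose edges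
are labelled `3, 3, 4`. -/
def affineB₃ : CoxeterMatrix (Fin 4) where
  M := !![1, 3, 3, 4;
          3, 1, 2, 2;
          3, 2, 1, 2;
          4, 2, 2, 1]
  isSymm := by ext i j; fin_cases i <;> fin_cases j <;> rfl
  diagonal i := by fin_cases i <;> rfl
  off_diagonal i j := by fin_cases i <;> fin_cases j <;> simp

/-- The matrix `-2 cos (π / M i j)` of the canonical bilinear form of a Coxeter group, normalized
so that simple roots have norm `2`. -/
def geomMatrix {κ : Type*} (M : CoxeterMatrix κ) : Matrix κ κ ℝ :=
  Matrix.of fun i j => -2 * Real.cos (Real.pi / M i j)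

theorem geom_isCartan {κ : Type*} (M : CoxeterMatrix κ) : IsCartan M (geomMatrix M) where
  diag i := by simp [geomMatrix]
  comm i j h := by simp [geomMatrix, h]
  root i j _ := by
    have e : geomMatrix M i j * geomMatrix M j i = 4 * Real.cos (Real.pi / M i j) ^ 2 := by
      simp only [geomMatrix, Matrix.of_apply, M.symmetric j i]
      ring
    rw [e]
    exact minpoly.aeval _ _

/-- The root system of the geometric representation: the orbit of the simple roots. -/
def roots (M : CoxeterMatrix ι) : Set (ι → ℝ) :=
  {r | ∃ (w : M.Group) (i : ι), r = reflRep (geom_isCartan M) w (Pi.single i 1)}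

/-- `g` is an affine reflection of the root system, that is, the orthogonal reflection in the
affine hyperplane `{x | ⟨x, r⟩ = k}`, with `r` a root (of norm `2`) and `k` an integer. -/
def IsAffineReflection (M : CoxeterMatrix ι) (g : (ι → ℝ) ≃ᵃ[ℝ] (ι → ℝ)) : Prop :=
  ∃ r ∈ roots M, ∃ k : ℤ, ∀ x, g x = x - (x ⬝ᵥ (geomMatrix M).mulVec r - k) • r

/-- The affine reflection group attached to a finite Coxeter group: the group of affine
transformations generated by the reflections in the hyperplanes `{x | ⟨x, r⟩ = k}`, with `r` a
root and `k` an integer. For `M = H₃` this is the affine reflection group of type `H₃`; it is the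
semidirect product of the finite reflection group and of the translations by the `ℤ`-span of the
roots. -/
def affineReflectionGroup (M : CoxeterMatrix ι) : Subgroup ((ι → ℝ) ≃ᵃ[ℝ] (ι → ℝ)) :=
  Subgroup.closure {g | IsAffineReflection M g}

end ReflRep

end

/-! Numbering as in the statement, Δ = (4 - α₁)(4 - α₃) - 4α₂ for the path and Δ = 4(4 - α₁ - α₂ -
α₃) for the star, so both classifications are arithmetic of the numbers 4cos²(kπ/p).

Path: Δ = 0 makes (4 - α₁)(4 - α₃) divisible by 4 among algebraic integers. By
`two_sub_dvd_trichotomy`, 4 - α divides an odd integer when p is not a power of two, equals 2 when p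
= 4, and has square dividing 2 when p = 8, 16, .... Only p₁ = p₃ = 4 provides a full factor 4
(`eq_four_of_mul_eq`).

Star: the mean of the conjugates of α is 2 + 2μ(p)/φ(p) (`normalizedTrace_vPoly`), so α₁ + α₂ + α₃ =
4 forces the three quotients μ(p)/φ(p) to sum to -1. The quotient is -1/2 for p = 3 and otherwise at
least -1/4, with equality only for p = 5 (`moebius_div_totient_bound`); few triples survive.

Types C̃₃ and B̃₃: the Cartan matrix is integral, and the classical positivity of roots
(`isNatVec_of_not_isRightDescent`) makes the representation faithful.

Type H̃₃: the kernel of the representation is compared with that of an affine action. Over ℝ with τ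
= φ + 1, φ the golden ratio, the basis vectors are read as affine functions on 3-space, H as the
constants and the sᵢ as affine reflections (`starRealization`). For general K, triviality of a word
and being a translation are integral polynomial conditions on τ, hence the same for τ and for φ + 1,
which have the same minimal polynomial. -/

noncomputable section

namespace ReflRep

/-! ### Divisibility properties of 2 - 2cos(2kπ/n) among algebraic integers. -/

section Integrality

open Polynomial

/-- Every integral polynomial relation satisfied by `r` is satisfied by `x`. -/
def Specializes {A B : Type*} [CommRing A] [CommRing B] (r : A) (x : B) : Prop :=
  ∀ f : ℤ[X], aeval r f = 0 → aeval x f = 0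

namespace Specializes

variable {A B : Type*} [CommRing A] [CommRing B] {r : A} {x : B}

theorem map_aeval (h : Specializes r x) (g : ℤ[X]) :
    Specializes (Polynomial.aeval r g) (Polynomial.aeval x g) := fun f hf => by
  rw [← aeval_comp] at hf ⊢
  exact h _ hf

theorem sq_sub_two (h : Specializes r x) : Specializes (r ^ 2 - 2) (x ^ 2 - 2) := by
  have := h.map_aeval (X ^ 2 - 2)
  rwa [map_sub, map_sub, map_pow, map_pow, aeval_X, aeval_X, map_ofNat, map_ofNat] at this

theorem sub_two (h : Specializes r x) : Specializes (r - 2) (x - 2) := by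
  have := h.map_aeval (X - 2)
  rwa [map_sub, map_sub, aeval_X, aeval_X, map_ofNat, map_ofNat] at this

/-- Brings relations from a field down to its ring of integers, where divisibility has content. -/
theorem of_injective {C : Type*} [CommRing C] {f : B →+* C} (hf : Function.Injective f)
    (h : Specializes r (f x)) : Specializes r x := fun g hg => by
  apply hf
  rw [map_zero, ← h g hg]
  exact (aeval_algHom_apply f.toIntAlgHom x g).symm

end Specializes

theorem specializes_of_aeval_minpoly {K : Type*} [Field K] [CharZero K] {r : ℝ} {x : K}
    (h : aeval x (minpoly ℚ r) = 0) : Specializes r x := fun f hf => by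
  have h1 : minpoly ℚ r ∣ f.map (algebraMap ℤ ℚ) := minpoly.dvd _ _ (by rwa [aeval_map_algebraMap])
  obtain ⟨q, hq⟩ := h1
  have := congrArg (aeval x) hq
  rwa [map_mul, h, zero_mul, aeval_map_algebraMap] at this

theorem isIntegral_four_mul_cos_sq (n : ℕ) : IsIntegral ℤ (4 * Real.cos (Real.pi / n) ^ 2 : ℝ) := by
  have h := (Real.isIntegral_two_mul_cos_rat_mul_pi (1 / n)).pow 2
  convert h using 1
  push_cast
  rw [mul_pow, one_div, inv_mul_eq_div]
  norm_num

theorem isIntegral_of_aeval_vPoly {K : Type*} [Field K] [CharZero K] {n : ℕ} {x : K}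
    (h : aeval x (vPoly n) = 0) : IsIntegral ℤ x := by
  obtain ⟨f, hf, hf0⟩ := isIntegral_four_mul_cos_sq n
  exact ⟨f, hf, specializes_of_aeval_minpoly h f hf0⟩

theorem four_mul_cos_sq_sub_two (n : ℕ) :
    (4 * Real.cos (Real.pi / n) ^ 2 - 2 : ℝ) = 2 * Real.cos (2 * Real.pi / n) := by
  rw [mul_div_assoc, Real.cos_two_mul]; ring

theorem two_mul_cos_sq_sub_two (n : ℕ) :
    ((2 * Real.cos (2 * Real.pi / (2 * n : ℕ))) ^ 2 - 2 : ℝ) =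
      2 * Real.cos (2 * Real.pi / n) := by
  have : 2 * Real.pi / n = 2 * (2 * Real.pi / (2 * n : ℕ)) := by
    push_cast
    rcases eq_or_ne (n : ℝ) 0 with h | h
    · simp [h]
    · field_simp
  rw [this, Real.cos_two_mul]; ring

section divisibility

variable {R : Type*} [CommRing R]

/-- The polynomial f = S_a + S_{a-1} vanishes at 2cos(2π/(2a+1)), hence at c, while f(2) = (a+1) +
a. Then 2 - c divides f(2) - f(c) = 2a + 1. -/
theorem two_sub_dvd_of_odd {a : ℕ} (ha : 0 < a) {c : R}
    (h : Specializes (2 * Real.cos (2 * Real.pi / (2 * a + 1 : ℕ))) c) :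
    2 - c ∣ ((2 * a + 1 : ℕ) : R) := by
  set m := 2 * a + 1 with hm
  set θ := 2 * Real.pi / m with hθ
  have hm0 : (m : ℝ) ≠ 0 := by positivity
  have hm' : (m : ℝ) = 2 * a + 1 := by rw [hm]; push_cast; ring
  have hsin : Real.sin θ ≠ 0 := by
    apply ne_of_gt
    apply Real.sin_pos_of_pos_of_lt_pi
    · positivity
    · rw [hθ, div_lt_iff₀ (by positivity)]
      have : (2 : ℝ) < m := by
        rw [hm']; have : (1 : ℝ) ≤ a := by exact_mod_cast ha
        linarith
      nlinarith [Real.pi_pos]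
  have key : aeval (2 * Real.cos θ) (Chebyshev.S ℤ a + Chebyshev.S ℤ (a - 1)) = (0 : ℝ) := by
    rw [map_add, Chebyshev.aeval_S, Chebyshev.aeval_S]
    apply (mul_eq_zero_iff_right hsin).mp
    rw [add_mul, Chebyshev.S_two_mul_real_cos, Chebyshev.S_two_mul_real_cos]
    have e1 : (((a : ℤ) : ℝ) + 1) * θ = Real.pi + Real.pi / m := by
      rw [hθ]; field_simp; push_cast; linear_combination -hm'
    have e2 : (((a - 1 : ℤ) : ℝ) + 1) * θ = Real.pi - Real.pi / m := by
      rw [hθ]; field_simp; push_cast; linear_combination -hm'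
    rw [e1, e2, Real.sin_add, Real.sin_sub, Real.sin_pi, Real.cos_pi]
    ring
  have h1 := h _ key
  have h2 := Polynomial.sub_dvd_eval_sub (2 : R) c
    ((Chebyshev.S ℤ a + Chebyshev.S ℤ (a - 1)).map (algebraMap ℤ R))
  rw [eval_map_algebraMap, eval_map_algebraMap] at h2
  rw [h1, sub_zero, map_add, Chebyshev.aeval_S, Chebyshev.aeval_S, Chebyshev.S_eval_two,
    Chebyshev.S_eval_two] at h2
  convert h2 using 1
  rw [hm]; push_cast; ring

/-- Doubling the angle replaces c by c² - 2, and 2 - (c² - 2) = (2 - c)(2 + c), so each factor 2 of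
n can be stripped off. -/
theorem two_sub_dvd_of_two_pow_mul_odd {a : ℕ} (ha : 0 < a) (k : ℕ) {c : R}
    (h : Specializes (2 * Real.cos (2 * Real.pi / (2 ^ k * (2 * a + 1) : ℕ))) c) :
    2 - c ∣ ((2 * a + 1 : ℕ) : R) := by
  induction k generalizing c with
  | zero => exact two_sub_dvd_of_odd ha (by simpa using h)
  | succ k ih =>
    have h1 := h.sq_sub_two
    rw [pow_succ' 2 k, mul_assoc, two_mul_cos_sq_sub_two] at h1
    exact Dvd.dvd.trans ⟨2 + c, by ring⟩ (ih h1)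

theorem eq_zero_of_specializes_four {c : R}
    (h : Specializes (2 * Real.cos (2 * Real.pi / (4 : ℕ))) c) : c = 0 := by
  have e : 2 * Real.pi / (4 : ℕ) = Real.pi / 2 := by push_cast; ring
  rw [e, Real.cos_pi_div_two] at h
  simpa using h X (by simp)

theorem two_sub_sq_dvd_two (k : ℕ) {c : R}
    (h : Specializes (2 * Real.cos (2 * Real.pi / (2 ^ k * 8 : ℕ))) c) :
    (2 - c) ^ 2 ∣ 2 := by
  induction k generalizing c with
  | zero =>
    have h1 := h.sq_sub_two
    rw [show 2 ^ 0 * 8 = 2 * 4 from rfl, two_mul_cos_sq_sub_two] at h1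
    have h2 := eq_zero_of_specializes_four h1
    -- Here c² = 2, so (2 - c)² = 2(3 - 2c), and 3 + 2c is the inverse of the unit 3 - 2c.
    exact ⟨3 + 2 * c, by linear_combination (-2 * c + 5) * h2⟩
  | succ k ih =>
    have h1 := h.sq_sub_two
    rw [pow_succ' 2 k, mul_assoc, two_mul_cos_sq_sub_two] at h1
    exact Dvd.dvd.trans ⟨(2 + c) ^ 2, by ring⟩ (ih h1)

theorem two_sub_dvd_trichotomy {n : ℕ} (hn : 3 ≤ n) {c : R}
    (h : Specializes (2 * Real.cos (2 * Real.pi / n)) c) :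
    (∃ m : ℕ, Odd m ∧ 2 - c ∣ (m : R)) ∨ (n = 4 ∧ c = 0) ∨ (2 - c) ^ 2 ∣ 2 := by
  obtain ⟨k, m, ⟨a, rfl⟩, rfl⟩ := Nat.exists_eq_two_pow_mul_odd (n := n) (by omega)
  rcases Nat.eq_zero_or_pos a with rfl | ha
  · rcases k with _ | _ | _ | k
    · norm_num at hn
    · norm_num at hn
    · exact Or.inr (Or.inl ⟨rfl, eq_zero_of_specializes_four h⟩)
    · refine Or.inr (Or.inr (two_sub_sq_dvd_two k ?_))
      rwa [show 2 ^ (k + 1 + 1 + 1) * (2 * 0 + 1) = 2 ^ k * 8 by ring] at h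
  · exact Or.inl ⟨_, ⟨a, rfl⟩, two_sub_dvd_of_two_pow_mul_odd ha k h⟩

end divisibility

/-- A quotient b/4 in the integral closure is a rational number integral over ℤ, hence an integer.
-/
theorem not_four_dvd {K : Type*} [Field K] [CharZero K] {b : ℤ} (hb : ¬ (4 : ℤ) ∣ b) :
    ¬ (4 : integralClosure ℤ K) ∣ (b : integralClosure ℤ K) := by
  rintro ⟨y, hy⟩
  have h1 : (b : K) = 4 * y := by 
    simpa [map_mul, map_ofNat] using congrArg (algebraMap (integralClosure ℤ K) K) hy
  have h2 : algebraMap ℚ K (b / 4) = y := by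
    rw [map_div₀]; simp [h1]
  have h3 : IsIntegral ℤ (b / 4 : ℚ) := by
    rw [← isIntegral_algebraMap_iff (algebraMap ℚ K).injective, h2]
    exact y.2
  obtain ⟨z, hz⟩ := IsIntegrallyClosed.isIntegral_iff.mp h3
  apply hb
  refine ⟨z, ?_⟩
  have : (z : ℚ) = b / 4 := hz
  rw [eq_div_iff (by norm_num)] at this
  have : z * 4 = b := by exact_mod_cast this
  rw [← this, mul_comm]

theorem four_dvd_of_dvd_odd_mul {R : Type*} [CommRing R] {m : ℕ} (hm : Odd m) {x : R}
    (h : 4 ∣ (m : R) * x) : 4 ∣ x := by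
  have h1 : IsCoprime ((4 : ℕ) : ℤ) (m : ℤ) := by
    rw [Nat.isCoprime_iff_coprime]
    exact (Nat.Coprime.pow_left 2 (Nat.coprime_two_left.mpr hm) :)
  have h2 : IsCoprime (4 : R) (m : R) := by simpa using h1.map (Int.castRingHom R)
  exact h2.dvd_of_dvd_mul_left h

section path

variable {K : Type*} [Field K] [CharZero K]

local notation "𝒪" => integralClosure ℤ K

/-- Multiplying the relation by m/x shows 4 ∣ m·y, and m is prime to 4, so 4 ∣ y. Each alternative
for y then makes 4 divide an odd integer or 2. -/
theorem not_odd_of_mul_eq {x y z : 𝒪} (h : x * y = 4 * z) {m : ℕ} (hm : Odd m)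
    (hx : x ∣ (m : 𝒪))
    (hy : (∃ m : ℕ, Odd m ∧ y ∣ (m : 𝒪)) ∨ y = 2 ∨ y ^ 2 ∣ 2) : False := by
  have h4 : 4 ∣ y := by
    apply four_dvd_of_dvd_odd_mul hm
    obtain ⟨w, hw⟩ := hx
    exact ⟨w * z, by rw [hw]; linear_combination w * h⟩
  rcases hy with ⟨m', hm', hd⟩ | rfl | hd
  · refine not_four_dvd (K := K) (b := m') ?_ (by exact_mod_cast h4.trans hd)
    rcases hm' with ⟨k, rfl⟩
    omega
  · exact not_four_dvd (K := K) (b := 2) (by norm_num) (by exact_mod_cast h4)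
  · exact not_four_dvd (K := K) (b := 2) (by norm_num)
      (by exact_mod_cast (h4.trans (Dvd.intro_left _ (pow_succ y 1).symm)).trans hd)

theorem eq_four_of_mul_eq {n n' : ℕ} (hn : 3 ≤ n) (hn' : 3 ≤ n') {c c' z : 𝒪}
    (hc : Specializes (2 * Real.cos (2 * Real.pi / n)) c)
    (hc' : Specializes (2 * Real.cos (2 * Real.pi / n')) c')
    (h : (2 - c) * (2 - c') = 4 * z) : n = 4 ∧ n' = 4 ∧ c = 0 ∧ c' = 0 := by
  have imp : ∀ {n : ℕ} {c : 𝒪}, ((∃ m : ℕ, Odd m ∧ 2 - c ∣ (m : 𝒪)) ∨ (n = 4 ∧ c = 0) ∨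
      (2 - c) ^ 2 ∣ 2) → ((∃ m : ℕ, Odd m ∧ 2 - c ∣ (m : 𝒪)) ∨ 2 - c = 2 ∨ (2 - c) ^ 2 ∣ 2) := by
    rintro n c (h | ⟨_, rfl⟩ | h)
    · exact Or.inl h
    · exact Or.inr (Or.inl (sub_zero _))
    · exact Or.inr (Or.inr h)
  have t := two_sub_dvd_trichotomy hn hc
  have t' := two_sub_dvd_trichotomy hn' hc'
  -- Once odd divisors are excluded, each square is 4 (n = 4) or a divisor of 2 (n = 8, 16, ...).
  -- Unless both are 4 their product divides 8; but the product is 16z², which would give 4 ∣ 2.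
  have no : ¬ ((2 - c) ^ 2 * (2 - c') ^ 2 ∣ ((8 : ℤ) : 𝒪)) := by
    intro hd
    have e : (2 - c) ^ 2 * (2 - c') ^ 2 = 16 * z ^ 2 := by
      rw [← mul_pow, h]; ring
    rw [e] at hd
    obtain ⟨w, hw⟩ := hd
    refine not_four_dvd (K := K) (b := 2) (by norm_num) ⟨z ^ 2 * w, ?_⟩
    have h4 : (4 : 𝒪) ≠ 0 := by norm_num
    apply mul_left_cancel₀ h4
    push_cast at hw ⊢
    linear_combination hw
  have h' : (2 - c') * (2 - c) = 4 * z := by rw [mul_comm, h]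
  rcases t with ⟨m, hm, hd⟩ | ⟨rfl, rfl⟩ | hd
  · exact (not_odd_of_mul_eq h hm hd (imp t')).elim
  · rcases t' with ⟨m', hm', hd'⟩ | ⟨rfl, rfl⟩ | hd'
    · exact (not_odd_of_mul_eq h' hm' hd' (Or.inr (Or.inl (sub_zero _)))).elim
    · simp
    · refine (no ?_).elim
      have := mul_dvd_mul (dvd_refl ((2 - 0 : 𝒪) ^ 2)) hd'
      refine this.trans (dvd_of_eq ?_)
      norm_num
  · rcases t' with ⟨m', hm', hd'⟩ | ⟨rfl, rfl⟩ | hd'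
    · exact (not_odd_of_mul_eq h' hm' hd' (Or.inr (Or.inr hd))).elim
    · refine (no ?_).elim
      have := mul_dvd_mul hd (dvd_refl ((2 - 0 : 𝒪) ^ 2))
      refine this.trans (dvd_of_eq ?_)
      norm_num
    · refine (no ?_).elim
      refine (mul_dvd_mul hd hd').trans ⟨2, by norm_num⟩

end path

end Integrality

/-! ### The polynomials v_p, the two determinants, degenerate paths, and the mean of the roots of
v_p. -/

section ConjugateTraces

open Polynomial

theorem irreducible_vPoly (n : ℕ) : Irreducible (vPoly n) :=
  minpoly.irreducible (isIntegral_four_mul_cos_sq n).tower_top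

theorem minpoly_eq_vPoly {A : Type*} [Field A] [CharZero A] {n : ℕ} {x : A}
    (h : aeval x (vPoly n) = 0) : minpoly ℚ x = vPoly n :=
  (minpoly.eq_of_irreducible_of_monic (irreducible_vPoly n) h
    (minpoly.monic (isIntegral_four_mul_cos_sq n).tower_top)).symm

theorem vPoly_of_eq_algebraMap {n : ℕ} {q : ℚ}
    (h : (4 * Real.cos (Real.pi / n) ^ 2 : ℝ) = q) : vPoly n = X - C q := by
  rw [vPoly, h]
  exact minpoly.eq_X_sub_C ℝ q

theorem vPoly_three : vPoly 3 = X - C 1 := by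
  apply vPoly_of_eq_algebraMap
  have : Real.cos (Real.pi / (3 : ℕ)) = 1 / 2 := by exact_mod_cast Real.cos_pi_div_three
  rw [this]; norm_num

theorem vPoly_four : vPoly 4 = X - C 2 := by
  apply vPoly_of_eq_algebraMap
  have : Real.cos (Real.pi / (4 : ℕ)) = √2 / 2 := by exact_mod_cast Real.cos_pi_div_four
  rw [this, div_pow, Real.sq_sqrt (by norm_num)]; norm_num

theorem sq_sub_three_mul_add_one_eq_zero :
    aeval (4 * Real.cos (Real.pi / (5 : ℕ)) ^ 2 : ℝ) (X ^ 2 - 3 * X + 1 : ℤ[X]) = 0 := by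
  have : Real.cos (Real.pi / (5 : ℕ)) = (1 + √5) / 4 := by exact_mod_cast Real.cos_pi_div_five
  rw [this]
  have h5 : √5 ^ 2 = 5 := Real.sq_sqrt (by norm_num)
  simp only [map_add, map_sub, map_pow, map_mul, aeval_X, map_ofNat, map_one]
  linear_combination (√5 ^ 2 / 16 + √5 / 4 - 1 / 16) * h5

section cosine

theorem eq_of_four_mul_cos_sq_eq {m n : ℕ} (hm : 2 ≤ m) (hn : 2 ≤ n)
    (h : (4 * Real.cos (Real.pi / m) ^ 2 : ℝ) = 4 * Real.cos (Real.pi / n) ^ 2) : m = n := by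
  have bound : ∀ {k : ℕ}, 2 ≤ k → 0 ≤ Real.pi / k ∧ Real.pi / k ≤ Real.pi / 2 := fun {k} hk =>
    ⟨by positivity, div_le_div_of_nonneg_left Real.pi_pos.le (by norm_num) (by exact_mod_cast hk)⟩
  have cospos : ∀ {k : ℕ}, 2 ≤ k → 0 ≤ Real.cos (Real.pi / k) := fun {k} hk =>
    Real.cos_nonneg_of_neg_pi_div_two_le_of_le (by linarith [bound hk, Real.pi_pos]) (bound hk).2
  have h1 : Real.cos (Real.pi / m) = Real.cos (Real.pi / n) := by
    rw [← sq_eq_sq₀ (cospos hm) (cospos hn)]; linarith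
  have h2 := Real.injOn_cos (x₁ := Real.pi / m) (x₂ := Real.pi / n)
    ⟨(bound hm).1, by linarith [bound hm, Real.pi_pos]⟩
    ⟨(bound hn).1, by linarith [bound hn, Real.pi_pos]⟩ h1
  have hm0 : (m : ℝ) ≠ 0 := by positivity
  have hn0 : (n : ℝ) ≠ 0 := by positivity
  rw [div_eq_div_iff hm0 hn0] at h2
  exact_mod_cast (mul_left_cancel₀ Real.pi_ne_zero h2).symm

/-- Recovers a label from a rational α: a rational root makes the irreducible v_m linear, so the two
cosines agree, and cosine is injective on [0, π]. -/
theorem vPoly_injective {m n : ℕ} (hm : 2 ≤ m) (hn : 2 ≤ n) {q : ℚ} (h : vPoly n = X - C q)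
    (hq : aeval (algebraMap ℚ ℝ q) (vPoly m) = 0) : m = n := by
  have h1 : vPoly m = X - C q := by
    rw [← minpoly_eq_vPoly hq]
    exact minpoly.eq_X_sub_C ℝ q
  apply eq_of_four_mul_cos_sq_eq hm hn
  have e : ∀ {k : ℕ}, vPoly k = X - C q → (4 * Real.cos (Real.pi / k) ^ 2 : ℝ) = q := by
    intro k hk
    have := minpoly.aeval ℚ (4 * Real.cos (Real.pi / k) ^ 2 : ℝ)
    rw [← vPoly, hk] at this
    simpa [sub_eq_zero] using this
  rw [e h1, e h]

end cosine

variable {K : Type*} [Field K] [CharZero K]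

theorem eq_of_aeval_algebraMap {m n : ℕ} (hm : 2 ≤ m) (hn : 2 ≤ n) {q : ℚ}
    (h : vPoly n = X - C q) (hq : aeval (algebraMap ℚ K q) (vPoly m) = 0) : m = n := by
  apply vPoly_injective hm hn h
  rw [aeval_algebraMap_apply] at hq ⊢
  rw [(map_eq_zero _).mp hq, map_zero]

theorem aeval_vPoly_three {x : K} (h : aeval x (vPoly 3) = 0) : x = 1 := by
  rw [vPoly_three] at h
  simpa [sub_eq_zero] using h

theorem aeval_vPoly_four {x : K} (h : aeval x (vPoly 4) = 0) : x = 2 := by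
  rw [vPoly_four] at h
  simpa [sub_eq_zero] using h

theorem aeval_vPoly_five {x : K} (h : aeval x (vPoly 5) = 0) : x ^ 2 - 3 * x + 1 = 0 := by
  have := specializes_of_aeval_minpoly h _ sq_sub_three_mul_add_one_eq_zero
  simpa only [map_add, map_sub, map_pow, map_mul, aeval_X, map_ofNat, map_one] using this

theorem discr_path {p : Fin 3 → ℕ} (hp : ∀ i, 3 ≤ p i) {α : Fin 3 → K}
    (hα : ∀ i, aeval (α i) (vPoly (p i)) = 0) :
    discr (path_isCartan hp hα) = (4 - α 0) * (4 - α 2) - 4 * α 1 := by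
  simp [discr, pathCartan, Matrix.det_succ_row_zero, Fin.sum_univ_succ, Fin.succAbove]
  ring

theorem discr_star {p : Fin 3 → ℕ} (hp : ∀ i, 3 ≤ p i) {α : Fin 3 → K}
    (hα : ∀ i, aeval (α i) (vPoly (p i)) = 0) :
    discr (star_isCartan hp hα) = 4 * (4 - (α 0 + α 1 + α 2)) := by
  simp [discr, starCartan, Matrix.det_succ_row_zero, Fin.sum_univ_succ, Fin.succAbove]
  ring

theorem specializes_vPoly {n : ℕ} {x : K} (h : aeval x (vPoly n) = 0) :
    Specializes (2 * Real.cos (2 * Real.pi / n))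
      ((⟨x, isIntegral_of_aeval_vPoly h⟩ : integralClosure ℤ K) - 2) := by
  rw [← four_mul_cos_sq_sub_two]
  apply Specializes.sub_two
  apply Specializes.of_injective (f := (algebraMap (integralClosure ℤ K) K))
    Subtype.val_injective
  exact specializes_of_aeval_minpoly h

theorem discr_path_eq_zero_iff {p : Fin 3 → ℕ} (hp : ∀ i, 3 ≤ p i) {α : Fin 3 → K}
    (hα : ∀ i, aeval (α i) (vPoly (p i)) = 0) :
    discr (path_isCartan hp hα) = 0 ↔ p = ![4, 3, 4] ∧ α = ![2, 1, 2] := by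
  rw [discr_path hp hα]
  constructor
  · intro h
    -- With c = α - 2, a conjugate of 2cos(2π/p), one has 4 - α = 2 - c.
    obtain ⟨h0, h2, -, -⟩ := eq_four_of_mul_eq (hp 0) (hp 2) (specializes_vPoly (hα 0))
      (specializes_vPoly (hα 2)) (z := ⟨α 1, isIntegral_of_aeval_vPoly (hα 1)⟩) (by
        apply Subtype.val_injective
        change (2 - (α 0 - 2)) * (2 - (α 2 - 2)) = 4 * α 1
        linear_combination h)
    have a0 : α 0 = 2 := aeval_vPoly_four (h0 ▸ hα 0)
    have a2 : α 2 = 2 := aeval_vPoly_four (h2 ▸ hα 2)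
    have a1 : α 1 = 1 := by
      have h4 : (4 : K) ≠ 0 := by norm_num
      apply mul_left_cancel₀ h4
      rw [a0, a2] at h
      linear_combination -h
    have h1 : p 1 = 3 := by
      have := hα 1
      rw [a1] at this
      exact eq_of_aeval_algebraMap (K := K) (by linarith [hp 1]) (by norm_num) vPoly_three
        (by simpa using this)
    constructor
    · ext i; fin_cases i <;> simp [h0, h1, h2]
    · ext i; fin_cases i <;> simp [a0, a1, a2]
  · rintro ⟨-, rfl⟩
    simp
    norm_num

section trace

theorem sum_nthRootsFinset {n : ℕ} (hn : 0 < n) :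
    ∑ z ∈ nthRootsFinset n (1 : ℂ), z = if n = 1 then 1 else 0 := by
  split_ifs with h1
  · subst h1
    have : nthRootsFinset 1 (1 : ℂ) = {1} := by
      ext z; simp [mem_nthRootsFinset]
    simp [this]
  · have hz := Complex.isPrimitiveRoot_exp n hn.ne'
    set ζ := Complex.exp (2 * Real.pi * Complex.I / n)
    have hζ0 : ζ ≠ 0 := hz.ne_zero hn.ne'
    -- Multiplication by ζ permutes the n-th roots of unity; as ζ ≠ 1, their sum must vanish.
    have e : ζ * ∑ z ∈ nthRootsFinset n (1 : ℂ), z = ∑ z ∈ nthRootsFinset n (1 : ℂ), z := by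
      rw [Finset.mul_sum]
      refine Finset.sum_nbij' (ζ * ·) (ζ⁻¹ * ·) ?_ ?_ ?_ ?_ ?_
      · intro z h
        rw [mem_nthRootsFinset hn] at h ⊢
        rw [mul_pow, hz.pow_eq_one, h, one_mul]
      · intro z h
        rw [mem_nthRootsFinset hn] at h ⊢
        rw [mul_pow, inv_pow, hz.pow_eq_one, h, inv_one, one_mul]
      · intro z _; simp [hζ0]
      · intro z _; simp [hζ0]
      · intro z _; rfl
    have h2 : (ζ - 1) * ∑ z ∈ nthRootsFinset n (1 : ℂ), z = 0 := by linear_combination e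
    exact (mul_eq_zero.mp h2).resolve_left (sub_ne_zero.mpr (hz.ne_one (by omega)))

-- Möbius inversion: the n-th roots of unity are the disjoint union of the primitive d-th roots for
-- d ∣ n, and their sum is 0 except for n = 1.
open ArithmeticFunction in
theorem sum_primitiveRoots_eq_moebius {n : ℕ} (hn : 0 < n) :
    ∑ z ∈ primitiveRoots n ℂ, z = (moebius n : ℂ) := by
  classical
  have h := (sum_eq_iff_sum_mul_moebius_eq (f := fun n => ∑ z ∈ primitiveRoots n ℂ, z)
    (g := fun n => if n = 1 then 1 else 0)).mp (by
      intro n hn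
      rw [← Finset.sum_biUnion fun a _ b _ hab => IsPrimitiveRoot.disjoint hab,
        ← IsPrimitiveRoot.nthRoots_one_eq_biUnion_primitiveRoots]
      exact sum_nthRootsFinset hn) n hn
  rw [← h]
  rw [Finset.sum_eq_single (n, 1)]
  · simp
  · rintro ⟨a, b⟩ hab hne
    rw [Nat.mem_divisorsAntidiagonal] at hab
    have : b ≠ 1 := by
      rintro rfl
      apply hne
      simp_all
    simp [this]
  · intro h; exact (h (by simp [hn.ne'])).elim

/-- The mean of the conjugates, read off from the minimal polynomial. -/
theorem normalizedTrace_vPoly {A : Type*} [Field A] [CharZero A] [Algebra.IsIntegral ℚ A] {n : ℕ}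
    (hn : 0 < n) {x : A} (h : aeval x (vPoly n) = 0) :
    Algebra.normalizedTrace ℚ A x = 2 + 2 * (ArithmeticFunction.moebius n / n.totient) := by
  have hz := Complex.isPrimitiveRoot_exp n hn.ne'
  set ζ := Complex.exp (2 * Real.pi * Complex.I / n) with hζ
  let E := algebraicClosure ℚ ℂ
  have : Algebra.IsIntegral ℚ E := 
    Algebra.isAlgebraic_iff_isIntegral.mp (algebraicClosure.isAlgebraic ℚ ℂ)
  have mem : ∀ {z : ℂ}, IsPrimitiveRoot z n → z ∈ E := fun {z} h =>
    mem_algebraicClosure_iff.mpr (h.isIntegral hn).tower_top.isAlgebraic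
  -- All primitive n-th roots have minimal polynomial Φ_n and so the same normalized trace, which is
  -- therefore μ(n)/φ(n).
  have tr : ∀ {z : E}, IsPrimitiveRoot (z : ℂ) n →
      Algebra.normalizedTrace ℚ E z = Algebra.normalizedTrace ℚ E ⟨ζ, mem hz⟩ := by
    intro z hz'
    rw [Algebra.normalizedTrace_minpoly, Algebra.normalizedTrace_minpoly]
    have e : ∀ w : E, minpoly ℚ w = minpoly ℚ (w : ℂ) := fun w =>
      (minpoly.algebraMap_eq (B := E) (B' := ℂ) Subtype.val_injective w).symm
    rw [e, e, ← cyclotomic_eq_minpoly_rat hz' hn, ← cyclotomic_eq_minpoly_rat hz hn]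
  have trζ : (n.totient : ℚ) * Algebra.normalizedTrace ℚ E ⟨ζ, mem hz⟩ =
      ArithmeticFunction.moebius n := by
    have s : ∑ z ∈ (primitiveRoots n ℂ).attach,
        (⟨z, mem ((mem_primitiveRoots hn).mp z.2)⟩ : E) =
          algebraMap ℚ E (ArithmeticFunction.moebius n) := by
      apply Subtype.val_injective
      have := sum_primitiveRoots_eq_moebius hn
      rw [← Finset.sum_attach] at this
      simpa using this
    have := congrArg (Algebra.normalizedTrace ℚ E) s
    rw [map_sum, Finset.sum_congr rfl fun z _ => tr ((mem_primitiveRoots hn).mp z.2)] at this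
    rw [Algebra.normalizedTrace_algebraMap_apply_eq_self] at this
    simpa [hz.card_primitiveRoots] using this
  -- This is 4cos²(π/n). The normalized trace depends only on the minimal polynomial, so x in `A`
  -- may be exchanged for y in `E`.
  let y : E := 2 + ⟨ζ, mem hz⟩ + ⟨ζ⁻¹, mem hz.inv⟩
  have hy : (y : ℂ) = ((4 * Real.cos (Real.pi / n) ^ 2 : ℝ) : ℂ) := by
    have e : (4 * Real.cos (Real.pi / n) ^ 2 : ℝ) = 2 + 2 * Real.cos (2 * Real.pi / n) := by
      linarith [four_mul_cos_sq_sub_two n]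
    rw [e]
    change 2 + ζ + ζ⁻¹ = _
    push_cast
    rw [Complex.two_cos, hζ, ← Complex.exp_neg, add_assoc]
    congr 3 <;> ring
  have hmin : minpoly ℚ y = vPoly n := by
    rw [← minpoly.algebraMap_eq (B := E) (B' := ℂ) Subtype.val_injective y]
    change minpoly ℚ (y : ℂ) = _
    rw [hy]
    exact minpoly.algebraMap_eq (B := ℝ) (B' := ℂ) Complex.ofReal_injective _
  rw [Algebra.normalizedTrace_minpoly, minpoly_eq_vPoly h, ← hmin,
    ← Algebra.normalizedTrace_minpoly]
  rw [map_add, map_add, tr (z := ⟨ζ⁻¹, mem hz.inv⟩) hz.inv]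
  have h2 : Algebra.normalizedTrace ℚ E 2 = 2 := by
    simpa using Algebra.normalizedTrace_algebraMap_apply_eq_self ℚ E 2
  have hφ : (n.totient : ℚ) ≠ 0 := by exact_mod_cast (Nat.totient_pos.mpr hn).ne'
  rw [h2, ← trζ]
  field_simp
  ring

end trace

end ConjugateTraces

/-! ### Classification of degenerate stars, and the fixed line. -/

section Classification

open Polynomial

-- If φ(n) ≥ 5 the quotient is at least -1/5, and if n is not squarefree it is 0. Otherwise φ(n) ≤ 4
-- leaves only primes up to 5, so n divides 30 and a finite check remains.
open ArithmeticFunction in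
theorem moebius_div_totient_bound {n : ℕ} (hn : 3 ≤ n) (h3 : n ≠ 3) :
    -(1 / 4 : ℚ) ≤ moebius n / n.totient ∧ (moebius n / n.totient = -(1 / 4 : ℚ) → n = 5) := by
  have hφ : (0 : ℚ) < n.totient := by exact_mod_cast Nat.totient_pos.mpr (by omega)
  have hμ : (-1 : ℚ) ≤ moebius n := by exact_mod_cast (abs_le.mp (abs_moebius_le_one (n := n))).1
  by_cases h5 : 5 ≤ n.totient
  · have h5' : (5 : ℚ) ≤ n.totient := by exact_mod_cast h5
    have : -(1 / 4 : ℚ) < moebius n / n.totient := by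
      rw [lt_div_iff₀ hφ]; linarith
    exact ⟨this.le, fun h => (this.ne' h).elim⟩
  by_cases hsq : Squarefree n
  swap
  · rw [moebius_eq_zero_of_not_squarefree hsq]; norm_num
  have hpr : n.primeFactors ⊆ {2, 3, 5} := by
    intro q hq
    have hq' := Nat.prime_of_mem_primeFactors hq
    have h1 := Nat.le_of_dvd (Nat.totient_pos.mpr (by omega))
      (Nat.totient_dvd_of_dvd (Nat.dvd_of_mem_primeFactors hq))
    rw [Nat.totient_prime hq'] at h1
    have h2 : q ≤ 5 := by omega
    have h3 := hq'.two_le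
    interval_cases q
    · simp
    · simp
    · norm_num at hq'
    · simp
  have hd : n ∣ 30 := by
    rw [← Nat.prod_primeFactors_of_squarefree hsq]
    exact Finset.prod_dvd_prod_of_subset _ _ (fun q => q) hpr
  have hmem : n ∈ Nat.divisors 30 := by simpa using hd
  have e : Nat.divisors 30 = {1, 2, 3, 5, 6, 10, 15, 30} := by decide
  rw [e] at hmem
  have h6 : moebius 6 = 1 := by
    rw [show 6 = 2 * 3 from rfl, isMultiplicative_moebius.map_mul_of_coprime (by norm_num),
      moebius_apply_prime Nat.prime_two, moebius_apply_prime Nat.prime_three]; rfl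
  have h10 : moebius 10 = 1 := by
    rw [show 10 = 2 * 5 from rfl, isMultiplicative_moebius.map_mul_of_coprime (by norm_num),
      moebius_apply_prime Nat.prime_two, moebius_apply_prime Nat.prime_five]; rfl
  simp only [Finset.mem_insert, Finset.mem_singleton] at hmem
  rcases hmem with rfl | rfl | rfl | rfl | rfl | rfl | rfl | rfl
  · omega
  · omega
  · omega
  · rw [moebius_apply_prime Nat.prime_five, Nat.totient_prime Nat.prime_five]; norm_num
  · rw [h6, show Nat.totient 6 = 2 by decide]; norm_num
  · rw [h10, show Nat.totient 10 = 4 by decide]; norm_num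
  · exact (h5 (by decide)).elim
  · exact (h5 (by decide)).elim

theorem moebius_div_totient_three :
    (ArithmeticFunction.moebius 3 / Nat.totient 3 : ℚ) = -(1 / 2) := by
  rw [ArithmeticFunction.moebius_apply_prime Nat.prime_three, Nat.totient_prime Nat.prime_three]
  norm_num

theorem exists_perm_three : ∀ i j k : Fin 3, i ≠ j → i ≠ k → j ≠ k →
    ∃ σ : Equiv.Perm (Fin 3), σ 0 = i ∧ σ 1 = j ∧ σ 2 = k := by decide

theorem sum_three {M : Type*} [AddCommMonoid M] (f : Fin 3 → M) : ∀ i j k : Fin 3, i ≠ j → i ≠ k →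
    j ≠ k → f i + f j + f k = f 0 + f 1 + f 2 := by
  intro i j k hij hik hjk
  obtain ⟨σ, rfl, rfl, rfl⟩ := exists_perm_three i j k hij hik hjk
  have := Equiv.sum_comp σ f
  rwa [Fin.sum_univ_three, Fin.sum_univ_three] at this

variable {K : Type*} [Field K] [CharZero K]

/-- The normalized trace of the relation Σα = 4, taken in the algebraic closure of ℚ in K: the three
terms 2 + 2μ/φ add up to 4. -/
theorem sum_moebius_div_totient {p : Fin 3 → ℕ} (hp : ∀ i, 3 ≤ p i) {α : Fin 3 → K}
    (hα : ∀ i, aeval (α i) (vPoly (p i)) = 0) (h : α 0 + α 1 + α 2 = 4) :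
    (fun i => (ArithmeticFunction.moebius (p i) / (p i).totient : ℚ)) 0 +
      (fun i => (ArithmeticFunction.moebius (p i) / (p i).totient : ℚ)) 1 +
      (fun i => (ArithmeticFunction.moebius (p i) / (p i).totient : ℚ)) 2 = -1 := by
  let A := algebraicClosure ℚ K
  have : Algebra.IsIntegral ℚ A :=
    Algebra.isAlgebraic_iff_isIntegral.mp (algebraicClosure.isAlgebraic ℚ K)
  let a : Fin 3 → A := fun i =>
    ⟨α i, mem_algebraicClosure_iff.mpr (isIntegral_of_aeval_vPoly (hα i)).tower_top.isAlgebraic⟩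
  have ha : ∀ i, aeval (a i) (vPoly (p i)) = 0 := by
    intro i
    apply Subtype.val_injective
    have := aeval_algebraMap_apply K (a i) (vPoly (p i))
    exact this.symm.trans (hα i)
  have hsum : a 0 + a 1 + a 2 = algebraMap ℚ A 4 := by
    apply Subtype.val_injective
    change α 0 + α 1 + α 2 = _
    rw [h, map_ofNat]
    rfl
  have := congrArg (Algebra.normalizedTrace ℚ A) hsum
  rw [Algebra.normalizedTrace_algebraMap_apply_eq_self, map_add, map_add,
    normalizedTrace_vPoly (by linarith [hp 0]) (ha 0),
    normalizedTrace_vPoly (by linarith [hp 1]) (ha 1),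
    normalizedTrace_vPoly (by linarith [hp 2]) (ha 2)] at this
  simp only
  linarith

theorem discr_star_eq_zero_iff {p : Fin 3 → ℕ} (hp : ∀ i, 3 ≤ p i) {α : Fin 3 → K}
    (hα : ∀ i, aeval (α i) (vPoly (p i)) = 0) :
    discr (star_isCartan hp hα) = 0 ↔ ∃ σ : Equiv.Perm (Fin 3),
      (p ∘ σ = ![3, 3, 4] ∧ α ∘ σ = ![1, 1, 2]) ∨
      (p ∘ σ = ![5, 5, 3] ∧ ∃ τ : K, τ ^ 2 - 3 * τ + 1 = 0 ∧ α ∘ σ = ![τ, 3 - τ, 1]) := by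
  have hfun : ∀ {B : Type _} (f : Fin 3 → B) {a b c : B}, f 0 = a → f 1 = b → f 2 = c →
      f = ![a, b, c] := by
    rintro B f _ _ _ rfl rfl rfl
    ext i; fin_cases i <;> rfl
  have hfun' : ∀ {B : Type} (f : Fin 3 → B) {a b c : B}, f 0 = a → f 1 = b → f 2 = c →
      f = ![a, b, c] := by
    rintro B f _ _ _ rfl rfl rfl
    ext i; fin_cases i <;> rfl
  rw [discr_star hp hα]
  constructor
  · intro h
    have h4 : α 0 + α 1 + α 2 = 4 :=
      (sub_eq_zero.mp ((mul_eq_zero.mp h).resolve_left (by norm_num))).symm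
    have ht := sum_moebius_div_totient hp hα h4
    set t : Fin 3 → ℚ := fun i => ArithmeticFunction.moebius (p i) / (p i).totient with ht'
    have b : ∀ i, p i ≠ 3 → -(1 / 4 : ℚ) ≤ t i ∧ (t i = -(1 / 4 : ℚ) → p i = 5) := fun i h =>
      moebius_div_totient_bound (hp i) h
    have t3 : ∀ i, p i = 3 → t i = -(1 / 2) ∧ α i = 1 := by
      intro i hi
      constructor
      · simp only [ht', hi]
        exact moebius_div_totient_three
      · exact aeval_vPoly_three (hi ▸ hα i)
    -- Two labels 3 leave α = 2 for the third branch, which pins its label to 4; this also rules out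
    -- three labels 3.
    have two : ∀ i j k, i ≠ j → i ≠ k → j ≠ k → p i = 3 → p j = 3 →
        ∃ σ : Equiv.Perm (Fin 3), p ∘ σ = ![3, 3, 4] ∧ α ∘ σ = ![1, 1, 2] := by
      intro i j k hij hik hjk hi hj
      have s := sum_three α i j k hij hik hjk
      rw [h4, (t3 i hi).2, (t3 j hj).2] at s
      have hk : α k = 2 := by linear_combination s
      have hpk : p k = 4 := by
        have := hα k
        rw [hk] at this
        exact eq_of_aeval_algebraMap (K := K) (by linarith [hp k]) (by norm_num) vPoly_four
          (by simpa using this)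
      obtain ⟨σ, rfl, rfl, rfl⟩ := exists_perm_three i j k hij hik hjk
      exact ⟨σ, hfun' _ hi hj hpk, hfun _ (t3 _ hi).2 (t3 _ hj).2 hk⟩
    have one : ∀ i j k, i ≠ j → i ≠ k → j ≠ k → p i = 3 → ∃ σ : Equiv.Perm (Fin 3),
        (p ∘ σ = ![3, 3, 4] ∧ α ∘ σ = ![1, 1, 2]) ∨
        (p ∘ σ = ![5, 5, 3] ∧ ∃ τ : K, τ ^ 2 - 3 * τ + 1 = 0 ∧ α ∘ σ = ![τ, 3 - τ, 1]) := by
      intro i j k hij hik hjk hi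
      by_cases hj : p j = 3
      · obtain ⟨σ, hσ⟩ := two i j k hij hik hjk hi hj
        exact ⟨σ, Or.inl hσ⟩
      by_cases hk : p k = 3
      · obtain ⟨σ, hσ⟩ := two i k j hik hij hjk.symm hi hk
        exact ⟨σ, Or.inl hσ⟩
      have s := sum_three t i j k hij hik hjk
      rw [ht, (t3 i hi).1] at s
      -- The two remaining quotients are at least -1/4 and sum to -1/2, so both bounds are attained.
      have hj5 := (b j hj).2 (by linarith [b j hj, b k hk])
      have hk5 := (b k hk).2 (by linarith [b j hj, b k hk])
      have s := sum_three α i j k hij hik hjk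
      rw [h4, (t3 i hi).2] at s
      obtain ⟨σ, rfl, rfl, rfl⟩ := exists_perm_three j k i hjk hij.symm hik.symm
      refine ⟨σ, Or.inr ⟨hfun' _ hj5 hk5 hi, α (σ 0), aeval_vPoly_five (hj5 ▸ hα (σ 0)),
        hfun _ rfl ?_ (t3 _ hi).2⟩⟩
      simp only [Function.comp_apply]
      linear_combination s
    by_cases h0 : p 0 = 3
    · exact one 0 1 2 (by decide) (by decide) (by decide) h0
    by_cases h1 : p 1 = 3
    · exact one 1 0 2 (by decide) (by decide) (by decide) h1
    by_cases h2 : p 2 = 3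
    · exact one 2 0 1 (by decide) (by decide) (by decide) h2
    -- Without a label 3 the sum is at least -3/4, not -1.
    linarith [b 0 h0, b 1 h1, b 2 h2]
  · rintro ⟨σ, h⟩
    have hs := Equiv.sum_comp σ α
    rw [Fin.sum_univ_three, Fin.sum_univ_three] at hs
    have e : ∀ {v : Fin 3 → K}, α ∘ σ = v → ∀ i, α (σ i) = v i := fun h i => congrFun h i
    rw [← hs]
    rcases h with ⟨-, h⟩ | ⟨-, τ, -, h⟩
    · rw [e h, e h, e h]
      simp; norm_num
    · rw [e h, e h, e h]
      simp; norm_num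

section fixedSpace

/-- Thus H is the kernel of C, because the vectors aᵢ are nonzero. -/
theorem mem_fixedSpace {ι : Type*} [Fintype ι] [DecidableEq ι] {M : CoxeterMatrix ι}
    {C : Matrix ι ι K} (h : IsCartan M C) {x : ι → K} :
    x ∈ fixedSpace h ↔ ∀ i, rowForm C i x = 0 := by
  simp only [fixedSpace, Submodule.mem_iInf, LinearMap.mem_ker]
  refine forall_congr' fun i => ?_
  rw [LinearMap.sub_apply, LinearMap.id_apply, LinearEquiv.coe_coe, simpleReflection,
    Module.reflection_apply, sub_sub_cancel_left, neg_eq_zero]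
  constructor
  · intro h
    simpa using congrFun h i
  · intro h
    rw [h, zero_smul]

theorem fixedSpace_path {p : Fin 3 → ℕ} (hp : ∀ i, 3 ≤ p i) {α : Fin 3 → K}
    (hα : ∀ i, aeval (α i) (vPoly (p i)) = 0) (h : discr (path_isCartan hp hα) = 0) :
    fixedSpace (path_isCartan hp hα) = Submodule.span K {![1, 1, 1, 1 / 2]} := by
  obtain ⟨-, rfl⟩ := (discr_path_eq_zero_iff hp hα).mp h
  ext x
  rw [mem_fixedSpace, Submodule.mem_span_singleton]
  simp only [rowForm, LinearMap.comp_apply, Matrix.mulVecLin_apply, LinearMap.proj_apply,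
    pathCartan, Fin.forall_fin_succ, Matrix.mulVec, dotProduct, Fin.sum_univ_four]
  simp
  constructor
  · rintro ⟨h0, h1, h2, h3⟩
    refine ⟨x 0, ?_⟩
    have e1 : x 1 = x 0 := by linear_combination -h0 / 2
    have e2 : x 2 = x 0 := by linear_combination 2 * e1 - h1
    have e3 : x 3 = x 0 / 2 := by linear_combination h3 / 2 + e2 / 2
    ext i; fin_cases i <;> simp [e1, e2, e3, div_eq_mul_inv]
  · rintro ⟨a, rfl⟩
    simp
    refine ⟨?_, ?_, ?_⟩ <;> ring

theorem fixedSpace_star {p : Fin 3 → ℕ} (hp : ∀ i, 3 ≤ p i) {α : Fin 3 → K}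
    (hα : ∀ i, aeval (α i) (vPoly (p i)) = 0) (h : discr (star_isCartan hp hα) = 0) :
    fixedSpace (star_isCartan hp hα) = Submodule.span K {![1, 1 / 2, 1 / 2, 1 / 2]} := by
  rw [discr_star hp hα] at h
  ext x
  rw [mem_fixedSpace, Submodule.mem_span_singleton]
  simp only [rowForm, LinearMap.comp_apply, Matrix.mulVecLin_apply, LinearMap.proj_apply,
    starCartan, Fin.forall_fin_succ, Matrix.mulVec, dotProduct, Fin.sum_univ_four]
  simp
  constructor
  · rintro ⟨h0, h1, h2, h3⟩
    refine ⟨x 0, ?_⟩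
    have e1 : x 1 = x 0 / 2 := by linear_combination h1 / 2
    have e2 : x 2 = x 0 / 2 := by linear_combination h2 / 2
    have e3 : x 3 = x 0 / 2 := by linear_combination h3 / 2
    ext i; fin_cases i <;> simp [e1, e2, e3, div_eq_mul_inv]
  · rintro ⟨a, rfl⟩
    simp
    exact ⟨by linear_combination a / 8 * h, by ring⟩

theorem finrank_span_fun {ι : Type*} {v : ι → K} {i : ι} (hv : v i = 1) :
    Module.finrank K (Submodule.span K {v}) = 1 :=
  finrank_span_singleton fun h => by simp [h] at hv

end fixedSpace

end Classification

/-! ### Faithfulness for integral Cartan matrices, by positivity of roots. -/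

section Faithfulness

open Polynomial CoxeterSystem

section words

variable {B W : Type*} [Group W] {M : CoxeterMatrix B} (cs : CoxeterSystem M W)

theorem alternatingWord_suffix (s t : B) {m k : ℕ} (h : m ≤ k) :
    ∃ L : List B, L.length = k - m ∧ alternatingWord s t k = L ++ alternatingWord s t m := by
  induction k, h using Nat.le_induction with
  | base => exact ⟨[], by simp, rfl⟩
  | succ k hk ih =>
    obtain ⟨L, hL, e⟩ := ih
    exact ⟨_ :: L, by simp [hL]; omega, by rw [alternatingWord_succ', e]; rfl⟩

/-- The decomposition of `w` along the dihedral subgroup generated by an ascent `s` and a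
descent `t`. -/
theorem exists_dihedral_decomposition {w : W} {s t : B} (hs : ¬ cs.IsRightDescent w s)
    (ht : cs.IsRightDescent w t) (hM : M s t ≠ 0) :
    ∃ (v : W) (k : ℕ), w = v * cs.wordProd (alternatingWord s t k) ∧ k < M s t ∧
      cs.length v < cs.length w ∧ ¬ cs.IsRightDescent v s ∧ ¬ cs.IsRightDescent v t := by
  classical
  let Q : ℕ → Prop := fun k => ∃ v : W, w = v * cs.wordProd (alternatingWord s t k) ∧
    cs.length w = cs.length v + k
  have Q1 : Q 1 := by
    refine ⟨w * cs.simple t, by simp [alternatingWord], ?_⟩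
    exact (cs.isRightDescent_iff.mp ht).symm
  have hw1 : 1 ≤ cs.length w := by
    have := cs.isRightDescent_iff.mp ht
    omega
  -- The longest alternating word ending in t that splits off from w on the right with lengths
  -- adding up.
  set k := Nat.findGreatest Q (cs.length w) with hk
  have hQ : Q k := Nat.findGreatest_spec hw1 Q1
  have hk1 : 1 ≤ k := Nat.le_findGreatest hw1 Q1
  obtain ⟨v, hv, hl⟩ := hQ
  -- A descent of v at the letter continuing the alternation would contradict the maximality of k.
  have next : ¬ cs.IsRightDescent v (if Even k then t else s) := by
    intro hd
    have hd' := cs.isRightDescent_iff.mp hd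
    have hQ' : Q (k + 1) := by
      refine ⟨v * cs.simple (if Even k then t else s), ?_, by omega⟩
      rw [alternatingWord_succ', wordProd_cons, ← mul_assoc, simple_mul_simple_cancel_right]
      exact hv
    exact Nat.findGreatest_is_greatest (Nat.lt_succ_self k) (by omega) hQ'
  -- A descent at the first letter of the alternating word would shorten w, as that letter cancels.
  have prev : ¬ cs.IsRightDescent v (if Even k then s else t) := by
    intro hd
    obtain ⟨j, hj⟩ : ∃ j, k = j + 1 := ⟨k - 1, by omega⟩
    have e : (if Even k then s else t) = if Even j then t else s := by
      rw [hj]; by_cases h : Even j <;> simp [h, Nat.even_add_one]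
    rw [e] at hd
    have hd' := cs.isRightDescent_iff.mp hd
    have hv' := hv
    rw [hj, alternatingWord_succ', wordProd_cons, ← mul_assoc] at hv'
    have h1 := cs.length_mul_le (v * cs.simple (if Even j then t else s))
      (cs.wordProd (alternatingWord s t j))
    have h2 := cs.length_wordProd_le (alternatingWord s t j)
    rw [length_alternatingWord] at h2
    rw [← hv'] at h1
    omega
  refine ⟨v, k, hv, ?_, by omega, ?_, ?_⟩
  -- If k ≥ `M s t`, the braid relation lets the alternating suffix end in s instead of t, making s
  -- a descent of w.
  · by_contra hkm
    obtain ⟨L, hL, e⟩ := alternatingWord_suffix s t (not_lt.mp hkm)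
    obtain ⟨j, hj⟩ : ∃ j, M s t = j + 1 := ⟨M s t - 1, by omega⟩
    have hb : cs.wordProd (alternatingWord s t (M s t)) =
        cs.wordProd (alternatingWord s t j) * cs.simple s := by
      have := cs.wordProd_braidWord_eq s t
      rw [braidWord, braidWord, M.symmetric t s] at this
      rw [this, hj, alternatingWord_succ, wordProd_concat]
    apply hs
    rw [IsRightDescent]
    have hws : w * cs.simple s = v * cs.wordProd (L ++ alternatingWord s t j) := by
      rw [hv, e, wordProd_append, wordProd_append, hb, ← mul_assoc, ← mul_assoc,
        simple_mul_simple_cancel_right, mul_assoc]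
    rw [hws]
    have h1 := cs.length_mul_le v (cs.wordProd (L ++ alternatingWord s t j))
    have h2 := cs.length_wordProd_le (L ++ alternatingWord s t j)
    rw [List.length_append, length_alternatingWord] at h2
    omega
  · by_cases h : Even k
    · simpa [h] using prev
    · simpa [h] using next
  · by_cases h : Even k
    · simpa [h] using next
    · simpa [h] using prev

end words

variable {ι K : Type*} [Fintype ι] [DecidableEq ι] [Field K] [CharZero K]

set_option linter.unusedSectionVars false

/-- The vector is a combination of the canonical basis with coefficients in `ℕ`. -/
def IsNatVec (x : ι → K) : Prop := ∃ n : ι → ℕ, x = fun i => (n i : K)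

theorem IsNatVec.combination {x y : ι → K} (hx : IsNatVec x) (hy : IsNatVec y) (a b : ℕ) :
    IsNatVec ((a : K) • x + (b : K) • y) := by
  obtain ⟨n, rfl⟩ := hx
  obtain ⟨m, rfl⟩ := hy
  exact ⟨fun i => a * n i + b * m i, by ext i; simp⟩

theorem isNatVec_single (i : ι) : IsNatVec (Pi.single i 1 : ι → K) :=
  ⟨Pi.single i 1, by ext j; by_cases h : j = i <;> simp [h]⟩

/-- Off the diagonal the entries are nonpositive integers, and the labels are at most `4`. -/
structure IsCrystallographic (M : CoxeterMatrix ι) (C : Matrix ι ι K) : Prop where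
  nat : ∀ i j, i ≠ j → ∃ n : ℕ, C i j = -n
  label : ∀ i j, i ≠ j → (M i j = 2 ∧ C i j = 0) ∨ (M i j = 3 ∧ C i j * C j i = 1) ∨
    (M i j = 4 ∧ C i j * C j i = 2)

variable {M : CoxeterMatrix ι} {C : Matrix ι ι K}

theorem reflRep_simple' (h : IsCartan M C) (i : ι) :
    reflRep h (M.toCoxeterSystem.simple i) = simpleReflection h i :=
  reflRep_simple h i

/-- The rank two case of positivity: labels at most 4 leave only k ≤ 3, and the images are computed
outright. -/
theorem reflRep_alternatingWord (h : IsCartan M C) (hc : IsCrystallographic M C) {s t : ι}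
    (hst : s ≠ t) {k : ℕ} (hk : k < M s t) : ∃ a b : ℕ,
      reflRep h (M.toCoxeterSystem.wordProd (alternatingWord s t k)) (Pi.single s 1) =
        (a : K) • Pi.single s 1 + (b : K) • Pi.single t 1 := by
  obtain ⟨c, hct⟩ := hc.nat t s hst.symm
  have e0 : reflRep h (M.toCoxeterSystem.wordProd (alternatingWord s t 0)) (Pi.single s 1) =
      Pi.single s 1 := by
    simp [alternatingWord]
  have e1 : reflRep h (M.toCoxeterSystem.wordProd (alternatingWord s t 1)) (Pi.single s 1) =
      Pi.single s 1 + (c : K) • Pi.single t 1 := by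
    rw [alternatingWord, alternatingWord, List.concat_eq_append, List.nil_append,
      wordProd_singleton, reflRep_simple', simpleReflection_single, hct]
    module
  have e2 : reflRep h (M.toCoxeterSystem.wordProd (alternatingWord s t 2)) (Pi.single s 1) =
      (C s t * C t s - 1) • Pi.single s 1 + (c : K) • Pi.single t 1 := by
    rw [alternatingWord_succ', wordProd_cons, map_mul, LinearEquiv.mul_apply, e1]
    rw [if_neg (by decide), reflRep_simple', map_add, map_smul, simpleReflection_single,
      simpleReflection_single, h.diag, hct]
    module
  have e3 : C s t * C t s = 2 → reflRep h (M.toCoxeterSystem.wordProd (alternatingWord s t 3))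
      (Pi.single s 1) = (1 : K) • Pi.single s 1 := by
    intro h2
    rw [alternatingWord_succ', wordProd_cons, map_mul, LinearEquiv.mul_apply, e2, h2]
    rw [if_pos (by decide), reflRep_simple', map_add, map_smul, map_smul, simpleReflection_single,
      simpleReflection_single, h.diag, hct]
    module
  have one : k < 2 → ∃ a b : ℕ,
      reflRep h (M.toCoxeterSystem.wordProd (alternatingWord s t k)) (Pi.single s 1) =
        (a : K) • Pi.single s 1 + (b : K) • Pi.single t 1 := by
    intro hk
    interval_cases k
    · exact ⟨1, 0, by rw [e0]; simp⟩
    · exact ⟨1, c, by rw [e1]; simp⟩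
  rcases hc.label s t hst with ⟨hm, -⟩ | ⟨hm, h1⟩ | ⟨hm, h2⟩
  · exact one (by omega)
  · rcases Nat.lt_or_ge k 2 with h' | h'
    · exact one h'
    · obtain rfl : k = 2 := by omega
      exact ⟨0, c, by rw [e2, h1]; simp⟩
  · rcases Nat.lt_or_ge k 2 with h' | h'
    · exact one h'
    · obtain rfl | rfl : k = 2 ∨ k = 3 := by omega
      · exact ⟨1, c, by rw [e2, h2]; norm_num⟩
      · exact ⟨1, 0, by rw [e3 h2]; simp⟩

/-- Induction on length: the dihedral factor sends a_s to a combination of a_s and a_t, and the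
shorter factor v has neither s nor t as a descent. Coefficients in ℕ stand in for positivity, since
K carries no order. -/
theorem isNatVec_of_not_isRightDescent (h : IsCartan M C) (hc : IsCrystallographic M C) :
    ∀ (n : ℕ) (w : M.Group), M.toCoxeterSystem.length w = n → ∀ s,
      ¬ M.toCoxeterSystem.IsRightDescent w s → IsNatVec (reflRep h w (Pi.single s 1)) := by
  intro n
  induction n using Nat.strong_induction_on with
  | _ n ih =>
    rintro w rfl s hs
    by_cases hw : w = 1
    · subst hw
      rw [map_one]
      exact isNatVec_single s
    obtain ⟨t, ht⟩ := M.toCoxeterSystem.exists_rightDescent_of_ne_one hw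
    have hst : s ≠ t := by rintro rfl; exact hs ht
    have hM : M s t ≠ 0 := by
      rcases hc.label s t hst with h | h | h <;> omega
    obtain ⟨v, k, rfl, hk, hl, hvs, hvt⟩ := exists_dihedral_decomposition _ hs ht hM
    obtain ⟨a, b, e⟩ := reflRep_alternatingWord h hc hst hk
    rw [map_mul, LinearEquiv.mul_apply, e, map_add, map_smul, map_smul]
    exact (ih _ hl v rfl s hvs).combination (ih _ hl v rfl t hvt) a b

/-- If w ≠ 1 acts trivially and s is a descent of w, then ws sends a_s to -a_s, although s is not a
descent of ws; in characteristic 0 this contradicts positivity. -/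
theorem reflRep_injective (h : IsCartan M C) (hc : IsCrystallographic M C) :
    Function.Injective (reflRep h) := by
  rw [injective_iff_map_eq_one]
  intro w hw
  by_contra hne
  obtain ⟨s, hs⟩ := M.toCoxeterSystem.exists_rightDescent_of_ne_one hne
  have h1 := (M.toCoxeterSystem.isRightDescent_iff_not_isRightDescent_mul).mp hs
  obtain ⟨n, hn⟩ := isNatVec_of_not_isRightDescent h hc _ _ rfl s h1
  rw [map_mul, hw, one_mul, reflRep_simple', simpleReflection_single, h.diag] at hn
  have := congrFun hn s
  simp only [Pi.sub_apply, Pi.smul_apply, Pi.single_eq_same, smul_eq_mul] at this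
  have : ((n s + 1 : ℕ) : K) = 0 := by push_cast; linear_combination -this
  exact Nat.succ_ne_zero _ (Nat.cast_eq_zero.mp this)

theorem exists_coxeterSystem {κ : Type*} {M' : CoxeterMatrix κ} (h : IsCartan M C)
    (hc : IsCrystallographic M C) (e : ι ≃ κ) (hM : M' = M.reindex e) :
    ∃ cs : CoxeterSystem M' (reflGroup h), ∀ i, cs.simple (e i) = gen h i := by
  subst hM
  let f : M.Group ≃* reflGroup h := MonoidHom.ofInjective (reflRep_injective h hc)
  refine ⟨(M.toCoxeterSystem.map f).reindex e, fun i => ?_⟩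
  rw [reindex_simple, Equiv.symm_apply_apply, map_simple]
  apply Subtype.ext
  exact reflRep_simple' h i

theorem exists_coxeterSystem_path {p : Fin 3 → ℕ} (hp : ∀ i, 3 ≤ p i) {α : Fin 3 → K}
    (hα : ∀ i, aeval (α i) (vPoly (p i)) = 0) (hpe : p = ![4, 3, 4]) (hαe : α = ![2, 1, 2]) :
    ∃ cs : CoxeterSystem affineC₃ (reflGroup (path_isCartan hp hα)),
      ∀ i, cs.simple i = gen (path_isCartan hp hα) i := by
  subst hpe hαe
  refine exists_coxeterSystem (path_isCartan hp hα) ⟨?_, ?_⟩ (Equiv.refl _) ?_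
  · intro i j hij
    fin_cases i <;> fin_cases j <;> simp [pathCartan] at hij ⊢ <;>
      first | (refine ⟨0, ?_⟩; simp; done) | (refine ⟨1, ?_⟩; simp; done) | (refine ⟨2, ?_⟩; simp)
  · intro i j hij
    fin_cases i <;> fin_cases j <;> simp [pathCartan, pathCoxeter] at hij ⊢
  · ext i j
    fin_cases i <;> fin_cases j <;> rfl

/-- The permutation of the nodes of the star that permutes the leaves by `σ`. -/
def starPerm (σ : Equiv.Perm (Fin 3)) : Equiv.Perm (Fin 4) :=
  Equiv.Perm.decomposeFin.symm (0, σ)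

@[simp] theorem starPerm_zero (σ : Equiv.Perm (Fin 3)) : starPerm σ 0 = 0 := by
  simp [starPerm]

@[simp] theorem starPerm_succ (σ : Equiv.Perm (Fin 3)) (k : Fin 3) :
    starPerm σ k.succ = (σ k).succ := by
  simp [starPerm]

theorem starCartan_starPerm (α : Fin 3 → K) (σ : Equiv.Perm (Fin 3)) (i j : Fin 4) :
    starCartan α (starPerm σ i) (starPerm σ j) = starCartan (α ∘ σ) i j := by
  have row : ∀ k, starCartan α 0 (Fin.succ k) = -α k := by intro k; fin_cases k <;> rfl
  have col : ∀ k, starCartan α (Fin.succ k) 0 = -1 := by intro k; fin_cases k <;> rfl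
  have row' : ∀ k, starCartan (α ∘ σ) 0 (Fin.succ k) = -α (σ k) := by intro k; fin_cases k <;> rfl
  have col' : ∀ k, starCartan (α ∘ σ) (Fin.succ k) 0 = -1 := by intro k; fin_cases k <;> rfl
  have leaf : ∀ (β : Fin 3 → K) (k l : Fin 3),
      starCartan β k.succ l.succ = if k = l then 2 else 0 := by
    intro β k l; fin_cases k <;> fin_cases l <;> rfl
  induction i using Fin.cases <;> induction j using Fin.cases
  · simp; rfl
  · simp [row, row']
  · simp [col, col']
  · simp [leaf]

theorem starCoxeter_starPerm {p : Fin 3 → ℕ} (hp : ∀ i, 3 ≤ p i) (σ : Equiv.Perm (Fin 3))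
    (hp' : ∀ i, 3 ≤ (p ∘ σ) i) (i j : Fin 4) :
    starCoxeter p hp (starPerm σ i) (starPerm σ j) = starCoxeter (p ∘ σ) hp' i j := by
  have row : ∀ (p : Fin 3 → ℕ) (hp : ∀ i, 3 ≤ p i) k, starCoxeter p hp 0 (Fin.succ k) = p k := by
    intro p hp k; fin_cases k <;> rfl
  have col : ∀ (p : Fin 3 → ℕ) (hp : ∀ i, 3 ≤ p i) k, starCoxeter p hp (Fin.succ k) 0 = p k := by
    intro p hp k; fin_cases k <;> rfl
  have leaf : ∀ (p : Fin 3 → ℕ) (hp : ∀ i, 3 ≤ p i) (k l : Fin 3),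
      starCoxeter p hp k.succ l.succ = if k = l then 1 else 2 := by
    intro p hp k l; fin_cases k <;> fin_cases l <;> rfl
  induction i using Fin.cases <;> induction j using Fin.cases
  · simp
  · simp [row]
  · simp [col]
  · simp [leaf]

theorem exists_coxeterSystem_star {p : Fin 3 → ℕ} (hp : ∀ i, 3 ≤ p i) {α : Fin 3 → K}
    (hα : ∀ i, aeval (α i) (vPoly (p i)) = 0) (σ : Equiv.Perm (Fin 3))
    (hpe : p ∘ σ = ![3, 3, 4]) (hαe : α ∘ σ = ![1, 1, 2]) :
    ∃ cs : CoxeterSystem affineB₃ (reflGroup (star_isCartan hp hα)),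
      cs.simple 0 = gen (star_isCartan hp hα) 0 ∧
      ∀ k : Fin 3, cs.simple k.succ = gen (star_isCartan hp hα) (σ k).succ := by
  have hp' : ∀ i, 3 ≤ (p ∘ σ) i := fun i => hp _
  have hM : ∀ i j, starCoxeter p hp (starPerm σ i) (starPerm σ j) = affineB₃ i j := by
    intro i j
    rw [starCoxeter_starPerm hp σ hp']
    simp only [starCoxeter, hpe]
    fin_cases i <;> fin_cases j <;> rfl
  have hC : ∀ i j, starCartan α (starPerm σ i) (starPerm σ j) =
      (starCartan ![1, 1, 2] i j : K) := by
    intro i j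
    rw [starCartan_starPerm, hαe]
  have hc : IsCrystallographic (starCoxeter p hp) (starCartan α) := by
    constructor
    · intro i j hij
      obtain ⟨i, rfl⟩ := (starPerm σ).surjective i
      obtain ⟨j, rfl⟩ := (starPerm σ).surjective j
      rw [hC]
      have hij : i ≠ j := fun h => hij (h ▸ rfl)
      fin_cases i <;> fin_cases j <;> simp [starCartan] at hij ⊢ <;>
        first | (refine ⟨0, ?_⟩; simp; done) | (refine ⟨1, ?_⟩; simp; done) | (refine ⟨2, ?_⟩; simp)
    · intro i j hij
      obtain ⟨i, rfl⟩ := (starPerm σ).surjective i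
      obtain ⟨j, rfl⟩ := (starPerm σ).surjective j
      rw [hC, hC, hM]
      have hij : i ≠ j := fun h => hij (h ▸ rfl)
      fin_cases i <;> fin_cases j <;> simp [starCartan, affineB₃] at hij ⊢
  obtain ⟨cs, hcs⟩ := exists_coxeterSystem (M' := affineB₃) (star_isCartan hp hα) hc
    (starPerm σ).symm (by
      ext i j
      rw [CoxeterMatrix.reindex_apply]
      exact (hM i j).symm)
  have hcs' : ∀ i, cs.simple i = gen (star_isCartan hp hα) (starPerm σ i) := by
    intro i
    rw [← hcs, Equiv.symm_apply_apply]
  exact ⟨cs, by rw [hcs', starPerm_zero], fun k => by rw [hcs', starPerm_succ]⟩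

end Faithfulness

/-! ### Real reflection representations as actions on affine functions, and change of field. -/

section AffineRealizations

open Polynomial CoxeterSystem

section geomForm

variable {κ : Type*} [Fintype κ] [DecidableEq κ] (N : CoxeterMatrix κ)

/-- The canonical bilinear form of the geometric representation. -/
def geomForm : LinearMap.BilinForm ℝ (κ → ℝ) := Matrix.toBilin' (geomMatrix N)

theorem geomForm_apply (x y : κ → ℝ) : geomForm N x y = x ⬝ᵥ (geomMatrix N).mulVec y :=
  Matrix.toBilin'_apply' _ _ _

theorem geomForm_comm (x y : κ → ℝ) : geomForm N x y = geomForm N y x := by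
  have h : (geomMatrix N).transpose = geomMatrix N := by
    ext i j; simp [geomMatrix, N.symmetric i j]
  rw [geomForm_apply, geomForm_apply, Matrix.dotProduct_mulVec, ← Matrix.mulVec_transpose, h,
    dotProduct_comm]

theorem rowForm_geomMatrix (i : κ) (x : κ → ℝ) :
    rowForm (geomMatrix N) i x = geomForm N x (Pi.single i 1) := by
  rw [geomForm_comm, geomForm_apply, single_one_dotProduct]
  rfl

theorem simpleReflection_geom (i : κ) (x : κ → ℝ) :
    simpleReflection (geom_isCartan N) i x =
      x - geomForm N x (Pi.single i 1) • (Pi.single i 1 : κ → ℝ) := by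
  rw [simpleReflection, Module.reflection_apply, rowForm_geomMatrix]

theorem geomForm_single_self (i : κ) : geomForm N (Pi.single i 1) (Pi.single i 1) = 2 := by
  rw [← rowForm_geomMatrix, rowForm_single, (geom_isCartan N).diag]

theorem geomForm_reflRep (w : N.Group) (x y : κ → ℝ) :
    geomForm N (reflRep (geom_isCartan N) w x) (reflRep (geom_isCartan N) w y) =
      geomForm N x y := by
  induction w using N.toCoxeterSystem.simple_induction generalizing x y with
  | simple i =>
    rw [reflRep_simple', simpleReflection_geom, simpleReflection_geom]
    simp only [map_sub, map_smul, LinearMap.sub_apply, LinearMap.smul_apply, smul_eq_mul,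
      geomForm_single_self, geomForm_comm N (Pi.single i 1) y]
    ring
  | one => rw [map_one]; rfl
  | mul v w hv hw => rw [map_mul, LinearEquiv.mul_apply, LinearEquiv.mul_apply, hv, hw]

theorem geomForm_root {r : κ → ℝ} (hr : r ∈ roots N) : geomForm N r r = 2 := by
  obtain ⟨w, i, rfl⟩ := hr
  rw [geomForm_reflRep, geomForm_single_self]

/-- The affine reflection `x ↦ x - (⟨x, r⟩ - k) r`. -/
def affineReflection {r : κ → ℝ} (hr : geomForm N r r = 2) (k : ℝ) :
    (κ → ℝ) ≃ᵃ[ℝ] (κ → ℝ) :=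
  (Module.reflection (x := r) (f := geomForm N r) hr).toAffineEquiv.trans
    (AffineEquiv.constVAdd ℝ _ (k • r))

theorem affineReflection_apply {r : κ → ℝ} (hr : geomForm N r r = 2) (k : ℝ) (x : κ → ℝ) :
    affineReflection N hr k x = x - (geomForm N x r - k) • r := by
  change k • r + Module.reflection (x := r) (f := geomForm N r) hr x = _
  rw [Module.reflection_apply, geomForm_comm]
  module

theorem isAffineReflection_iff {g : (κ → ℝ) ≃ᵃ[ℝ] (κ → ℝ)} :
    IsAffineReflection N g ↔ ∃ (r : κ → ℝ) (hr : r ∈ roots N) (k : ℤ),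
      g = affineReflection N (geomForm_root N hr) k := by
  simp only [IsAffineReflection]
  constructor
  · rintro ⟨r, hr, k, h⟩
    refine ⟨r, hr, k, AffineEquiv.ext fun x => ?_⟩
    rw [h, affineReflection_apply, geomForm_apply]
  · rintro ⟨r, hr, k, rfl⟩
    exact ⟨r, hr, k, fun x => by rw [affineReflection_apply, geomForm_apply]⟩

end geomForm

theorem affineEquiv_mul_apply {V : Type*} [AddCommGroup V] [Module ℝ V] (f g : V ≃ᵃ[ℝ] V)
    (x : V) : (f * g) x = f (g x) := rfl

section realization

set_option linter.unusedSectionVars false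

variable {ι κ : Type*} [Fintype ι] [DecidableEq ι] [Fintype κ] [DecidableEq κ]

/-- Affine functions `x ↦ ⟨x, r i⟩ - k i` whose multiples by `c i` transform under the reflections
in their zero sets as the canonical basis does under the reflections defined by `C`. -/
structure AffineRealization (C : Matrix ι ι ℝ) (N : CoxeterMatrix κ) where
  r : ι → κ → ℝ
  k : ι → ℝ
  c : ι → ℝ
  norm : ∀ i, geomForm N (r i) (r i) = 2
  c_ne : ∀ i, c i ≠ 0
  gram : ∀ i j, C i j * c i = c j * geomForm N (r i) (r j)
  sep : ∀ y, (∀ i, geomForm N y (r i) = 0) → y = 0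
  indep : ∀ a : ι → ℝ, ∑ j, (a j * c j) • r j = 0 → ∑ j, a j * c j * k j = 0 → a = 0

namespace AffineRealization

variable {M : CoxeterMatrix ι} {C : Matrix ι ι ℝ} {N : CoxeterMatrix κ}
  (A : AffineRealization C N)

/-- The vector part `∑ a j c j r j` of the affine function attached to `a`. -/
def vec : (ι → ℝ) →ₗ[ℝ] (κ → ℝ) := ∑ j, (LinearMap.proj j).smulRight (A.c j • A.r j)

/-- Minus the constant part of the affine function attached to `a`. -/
def level : (ι → ℝ) →ₗ[ℝ] ℝ := ∑ j, (A.c j * A.k j) • LinearMap.proj j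

/-- The affine function attached to `a`. -/
def pairing (a : ι → ℝ) (x : κ → ℝ) : ℝ := geomForm N x (A.vec a) - A.level a

/-- The reflection in the zero set of the `i`-th affine function. -/
def refl (i : ι) : (κ → ℝ) ≃ᵃ[ℝ] (κ → ℝ) := affineReflection N (A.norm i) (A.k i)

theorem vec_apply (a : ι → ℝ) : A.vec a = ∑ j, (a j * A.c j) • A.r j := by
  simp [vec, LinearMap.sum_apply, mul_smul]

theorem level_apply (a : ι → ℝ) : A.level a = ∑ j, a j * A.c j * A.k j := by
  simp [level, LinearMap.sum_apply]
  exact Finset.sum_congr rfl fun j _ => by ring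

theorem vec_single (i : ι) : A.vec (Pi.single i 1) = A.c i • A.r i := by
  rw [vec_apply, Finset.sum_eq_single i]
  · simp
  · intro j _ hj; simp [hj]
  · simp

theorem level_single (i : ι) : A.level (Pi.single i 1) = A.c i * A.k i := by
  rw [level_apply, Finset.sum_eq_single i]
  · simp
  · intro j _ hj; simp [hj]
  · simp

theorem rowForm_mul (i : ι) (a : ι → ℝ) :
    rowForm C i a * A.c i = geomForm N (A.r i) (A.vec a) := by
  have e : rowForm C i a = ∑ j, C i j * a j := rfl
  rw [e, vec_apply, map_sum, Finset.sum_mul]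
  refine Finset.sum_congr rfl fun j _ => ?_
  rw [map_smul, smul_eq_mul]
  linear_combination a j * A.gram i j

theorem pairing_simpleReflection (h : IsCartan M C) (i : ι) (a : ι → ℝ) (x : κ → ℝ) :
    A.pairing (simpleReflection h i a) x = A.pairing a (A.refl i x) := by
  have e := A.rowForm_mul i a
  rw [simpleReflection, Module.reflection_apply]
  simp only [pairing, refl, affineReflection_apply, map_sub, map_smul, vec_single, level_single,
    LinearMap.sub_apply, LinearMap.smul_apply, smul_eq_mul]
  linear_combination (-(geomForm N x (A.r i)) + A.k i) * e

theorem eq_of_pairing_eq {x y : κ → ℝ} (h : ∀ a, A.pairing a x = A.pairing a y) : x = y := by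
  rw [← sub_eq_zero]
  apply A.sep
  intro i
  have h1 := h (Pi.single i 1)
  simp only [pairing, vec_single, map_smul, smul_eq_mul] at h1
  apply mul_left_cancel₀ (A.c_ne i)
  rw [map_sub, LinearMap.sub_apply]
  linear_combination h1

theorem eq_zero_of_geomForm (A : AffineRealization C N) {x : κ → ℝ}
    (h : ∀ y, geomForm N y x = 0) : x = 0 :=
  A.sep x fun i => by rw [geomForm_comm]; exact h _

theorem eq_of_pairing_eq' {a b : ι → ℝ} (h : ∀ x, A.pairing a x = A.pairing b x) : a = b := by
  have h0 : A.level a = A.level b := by simpa [pairing] using h 0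
  have h1 : A.vec (a - b) = 0 := A.eq_zero_of_geomForm fun x => by
    have := h x
    simp only [pairing, h0] at this
    rw [map_sub, map_sub]
    linear_combination this
  have h2 : A.level (a - b) = 0 := by rw [map_sub, h0, sub_self]
  rw [← sub_eq_zero]
  exact A.indep _ (by rw [← vec_apply, h1]) (by rw [← level_apply, h2])

/-- The pairing carries the linear Coxeter relations over to the affine reflections. Moving a
product across it reverses the order, hence the exchange of i and j. -/
theorem isLiftable (h : IsCartan M C) : M.IsLiftable A.refl := by
  intro i j
  have key : ∀ (m : ℕ) (a : ι → ℝ) (x : κ → ℝ),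
      A.pairing (((simpleReflection h j * simpleReflection h i) ^ m) a) x =
        A.pairing a (((A.refl i * A.refl j) ^ m) x) := by
    intro m
    induction m with
    | zero => intro a x; rfl
    | succ m ih =>
      intro a x
      rw [pow_succ', pow_succ, LinearEquiv.mul_apply, LinearEquiv.mul_apply,
        pairing_simpleReflection, pairing_simpleReflection, ih]
      rfl
  refine AffineEquiv.ext fun x => A.eq_of_pairing_eq fun a => ?_
  rw [← key, ← M.symmetric j i, ReflRep.isLiftable h j i]
  rfl

/-- The affine representation of the Coxeter group. -/
def rep (h : IsCartan M C) : M.Group →* ((κ → ℝ) ≃ᵃ[ℝ] (κ → ℝ)) :=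
  M.toCoxeterSystem.lift ⟨A.refl, A.isLiftable h⟩

theorem rep_simple (h : IsCartan M C) (i : ι) : A.rep h (M.toCoxeterSystem.simple i) = A.refl i :=
  M.toCoxeterSystem.lift_apply_simple (A.isLiftable h) i

theorem pairing_reflRep (h : IsCartan M C) (w : M.Group) (a : ι → ℝ) (x : κ → ℝ) :
    A.pairing (reflRep h w a) (A.rep h w x) = A.pairing a x := by
  induction w using M.toCoxeterSystem.simple_induction generalizing a x with
  | simple i =>
    rw [reflRep_simple', rep_simple, pairing_simpleReflection, ← affineEquiv_mul_apply,
      ← rep_simple A h, ← map_mul, simple_mul_simple_self, map_one]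
    rfl
  | one => rw [map_one, map_one]; rfl
  | mul v w hv hw =>
    rw [map_mul, map_mul, LinearEquiv.mul_apply, affineEquiv_mul_apply, hv, hw]

theorem reflRep_eq_one_iff (h : IsCartan M C) (w : M.Group) :
    reflRep h w = 1 ↔ A.rep h w = 1 := by
  constructor
  · intro h1
    refine AffineEquiv.ext fun x => A.eq_of_pairing_eq fun a => ?_
    have := A.pairing_reflRep h w a x
    rwa [h1] at this
  · intro h1
    refine LinearEquiv.ext fun a => A.eq_of_pairing_eq' fun x => ?_
    have := A.pairing_reflRep h w a x
    rwa [h1] at this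

/-- So H corresponds to the constant affine functions. -/
theorem mem_fixedSpace_iff (h : IsCartan M C) (a : ι → ℝ) :
    a ∈ fixedSpace h ↔ A.vec a = 0 := by
  rw [mem_fixedSpace]
  constructor
  · intro ha
    apply A.sep
    intro i
    rw [geomForm_comm, ← rowForm_mul, ha, zero_mul]
  · intro ha i
    have := A.rowForm_mul i a
    rw [ha, map_zero] at this
    exact (mul_eq_zero.mp this).resolve_right (A.c_ne i)

theorem isTranslation_iff (h : IsCartan M C) (w : M.Group) :
    IsTranslation h (reflRep h w) ↔ ∃ v, ∀ x, A.rep h w x = x + v := by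
  -- Subtracting the invariance of the pairing at 0 removes the constants: the linear part of the
  -- affine map is dual to the action on vector parts, so one is trivial exactly when the other is.
  have diff : ∀ a x, geomForm N (A.rep h w x - A.rep h w 0) (A.vec (reflRep h w a)) =
      geomForm N x (A.vec a) := by
    intro a x
    have h1 := A.pairing_reflRep h w a x
    have h2 := A.pairing_reflRep h w a 0
    simp only [pairing, map_zero, LinearMap.zero_apply] at h1 h2
    rw [map_sub, LinearMap.sub_apply]
    linear_combination h1 - h2
  simp only [IsTranslation, A.mem_fixedSpace_iff, map_sub, sub_eq_zero]
  constructor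
  · intro ht
    refine ⟨A.rep h w 0, fun x => ?_⟩
    rw [← sub_eq_iff_eq_add, ← sub_eq_zero]
    apply A.sep
    intro i
    have := diff (Pi.single i 1) x
    rw [ht, vec_single, map_smul, map_smul] at this
    have := mul_left_cancel₀ (A.c_ne i) this
    rw [map_sub (geomForm N), LinearMap.sub_apply, this, sub_self]
  · rintro ⟨v, hv⟩ a
    rw [← sub_eq_zero]
    apply A.eq_zero_of_geomForm
    intro x
    have := diff a x
    rw [hv, hv, zero_add, add_sub_cancel_right] at this
    rw [map_sub, this, sub_self]

end AffineRealization

end realization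

section specialization

set_option linter.unusedSectionVars false

variable {ι K L : Type*} [Fintype ι] [DecidableEq ι] [Field K] [CharZero K] [Field L] [CharZero L]
  {M : CoxeterMatrix ι} {P : Matrix ι ι ℤ[X]} {t : K} {u : L}

theorem simpleReflection_eq_toLin' {C : Matrix ι ι K} (h : IsCartan M C) (i : ι) :
    (simpleReflection h i).toLinearMap =
      Matrix.toLin' (1 - Matrix.of fun j k => if j = i then C i k else 0) := by
  refine LinearMap.ext fun x => ?_
  rw [LinearEquiv.coe_coe, simpleReflection, Module.reflection_apply]
  rw [Matrix.toLin'_apply, Matrix.sub_mulVec, Matrix.one_mulVec]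
  congr 1
  ext j
  by_cases hj : j = i
  · subst hj
    simp [rowForm, Matrix.mulVec, dotProduct]
  · simp [hj, Matrix.mulVec, dotProduct]

/-- One matrix over ℤ[X] describes w in both fields, so conditions on w become integral relations
for t and for u. -/
theorem exists_polynomial_matrix (h : IsCartan M (P.map (aeval t)))
    (h' : IsCartan M (P.map (aeval u)))
    (w : M.Group) : ∃ Q : Matrix ι ι ℤ[X],
      (reflRep h w).toLinearMap = Matrix.toLin' (Q.map (aeval t)) ∧
      (reflRep h' w).toLinearMap = Matrix.toLin' (Q.map (aeval u)) := by
  induction w using M.toCoxeterSystem.simple_induction with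
  | simple i =>
    refine ⟨1 - Matrix.of fun j k => if j = i then P i k else 0, ?_, ?_⟩
    all_goals
      rw [reflRep_simple', simpleReflection_eq_toLin']
      congr 1
      ext j k
      by_cases hj : j = i <;> by_cases hk : j = k <;> 
        simp [hj, hk, Matrix.one_apply, apply_ite (aeval t), apply_ite (aeval u)]
  | one =>
    refine ⟨1, ?_, ?_⟩
    all_goals
      rw [map_one, Matrix.map_one _ (map_zero _) (map_one _), Matrix.toLin'_one]
      rfl
  | mul v w hv hw =>
    obtain ⟨Q, h1, h2⟩ := hv
    obtain ⟨Q', h1', h2'⟩ := hw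
    refine ⟨Q * Q', ?_, ?_⟩
    · rw [map_mul, Matrix.map_mul, Matrix.toLin'_mul, ← h1, ← h1']
      rfl
    · rw [map_mul, Matrix.map_mul, Matrix.toLin'_mul, ← h2, ← h2']
      rfl

theorem toLinearMap_eq_one_iff {Q : Matrix ι ι ℤ[X]} {g : (ι → K) ≃ₗ[K] (ι → K)}
    (hg : g.toLinearMap = Matrix.toLin' (Q.map (aeval t))) :
    g = 1 ↔ ∀ i j, aeval t ((Q - 1) i j) = 0 := by
  have e : g = 1 ↔ g.toLinearMap = Matrix.toLin' 1 := by
    rw [Matrix.toLin'_one, ← LinearEquiv.toLinearMap_inj]; rfl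
  rw [e, hg, (Matrix.toLin' (R := K) (m := ι) (n := ι)).injective.eq_iff, ← Matrix.ext_iff]
  refine forall_congr' fun i => forall_congr' fun j => ?_
  rw [Matrix.sub_apply, map_sub, sub_eq_zero, Matrix.map_apply, Matrix.one_apply, Matrix.one_apply]
  split_ifs <;> simp

/-- Since H is the kernel of the Cartan matrix C, being a translation means C(g - 1) = 0. -/
theorem isTranslation_iff_polynomial (h : IsCartan M (P.map (aeval t))) {Q : Matrix ι ι ℤ[X]}
    {g : (ι → K) ≃ₗ[K] (ι → K)} (hg : g.toLinearMap = Matrix.toLin' (Q.map (aeval t))) :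
    IsTranslation h g ↔ ∀ i j, aeval t ((P * (Q - 1)) i j) = 0 := by
  have e : IsTranslation h g ↔
      Matrix.toLin' ((P * (Q - 1)).map (aeval t)) = (0 : (ι → K) →ₗ[K] (ι → K)) := by
    have e1 : ∀ x, Matrix.toLin' ((P * (Q - 1)).map (aeval t)) x =
        (P.map (aeval t)).mulVecLin (g x - x) := by
      intro x
      have : g x = (Q.map (aeval t)).mulVec x := by
        rw [← Matrix.toLin'_apply, ← hg]; rfl
      rw [Matrix.map_mul, Matrix.toLin'_mul, LinearMap.comp_apply, this,
        Matrix.map_sub _ (map_sub _), Matrix.map_one _ (map_zero _) (map_one _), map_sub,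
        Matrix.toLin'_one]
      rfl
    simp only [IsTranslation, mem_fixedSpace, LinearMap.ext_iff, e1, funext_iff]
    rfl
  rw [e, LinearEquiv.map_eq_zero_iff, ← Matrix.ext_iff]
  rfl

theorem reflRep_eq_one_congr (hs : ∀ f : ℤ[X], aeval t f = 0 ↔ aeval u f = 0)
    {C : Matrix ι ι K} {C' : Matrix ι ι L} (hC : C = P.map (aeval t)) (hC' : C' = P.map (aeval u))
    (h : IsCartan M C) (h' : IsCartan M C') (w : M.Group) :
    reflRep h w = 1 ↔ reflRep h' w = 1 := by
  subst hC hC'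
  obtain ⟨Q, h1, h2⟩ := exists_polynomial_matrix h h' w
  rw [toLinearMap_eq_one_iff h1, toLinearMap_eq_one_iff h2]
  exact forall_congr' fun i => forall_congr' fun j => hs _

theorem isTranslation_congr (hs : ∀ f : ℤ[X], aeval t f = 0 ↔ aeval u f = 0)
    {C : Matrix ι ι K} {C' : Matrix ι ι L} (hC : C = P.map (aeval t)) (hC' : C' = P.map (aeval u))
    (h : IsCartan M C) (h' : IsCartan M C') (w : M.Group) :
    IsTranslation h (reflRep h w) ↔ IsTranslation h' (reflRep h' w) := by
  subst hC hC'
  obtain ⟨Q, h1, h2⟩ := exists_polynomial_matrix h h' w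
  rw [isTranslation_iff_polynomial h h1, isTranslation_iff_polynomial h' h2]
  exact forall_congr' fun i => forall_congr' fun j => hs _

end specialization

end AffineRealizations

/-! ### Generators of the affine group of type H₃ and its realization by the star. -/

section IcosahedralAffine

open Polynomial CoxeterSystem

section generation

variable {κ : Type*} [Fintype κ] [DecidableEq κ] (N : CoxeterMatrix κ)

/-- The linear action of the Coxeter group by affine maps. -/
def linearRep : N.Group →* ((κ → ℝ) ≃ᵃ[ℝ] (κ → ℝ)) where
  toFun w := (reflRep (geom_isCartan N) w).toAffineEquiv
  map_one' := by rw [map_one]; rfl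
  map_mul' v w := by rw [map_mul]; rfl

theorem linearRep_apply (w : N.Group) (x : κ → ℝ) :
    linearRep N w x = reflRep (geom_isCartan N) w x := rfl

theorem linearRep_inv_apply (w : N.Group) (x : κ → ℝ) :
    reflRep (geom_isCartan N) w ((linearRep N w)⁻¹ x) = x := by
  rw [← linearRep_apply, ← affineEquiv_mul_apply, mul_inv_cancel]
  rfl

theorem linearRep_conj_affineReflection (w : N.Group) {r r' : κ → ℝ} (hr : geomForm N r r = 2)
    (hr' : geomForm N r' r' = 2) (h : reflRep (geom_isCartan N) w r = r') (k : ℝ) :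
    linearRep N w * affineReflection N hr k * (linearRep N w)⁻¹ = affineReflection N hr' k := by
  subst h
  refine AffineEquiv.ext fun x => ?_
  rw [affineEquiv_mul_apply, affineEquiv_mul_apply, linearRep_apply, affineReflection_apply,
    affineReflection_apply, map_sub, map_smul, linearRep_inv_apply, ← geomForm_reflRep N w,
    linearRep_inv_apply]

theorem linearRep_conj_constVAdd (w : N.Group) (v : κ → ℝ) :
    linearRep N w * AffineEquiv.constVAdd ℝ (κ → ℝ) v * (linearRep N w)⁻¹ =
      AffineEquiv.constVAdd ℝ (κ → ℝ) (reflRep (geom_isCartan N) w v) := by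
  refine AffineEquiv.ext fun x => ?_
  rw [affineEquiv_mul_apply, affineEquiv_mul_apply, linearRep_apply, AffineEquiv.constVAdd_apply,
    AffineEquiv.constVAdd_apply, vadd_eq_add, map_add, linearRep_inv_apply, vadd_eq_add]

theorem affineReflection_eq_mul {r : κ → ℝ} (hr : geomForm N r r = 2) (k : ℝ) :
    affineReflection N hr k =
      AffineEquiv.constVAdd ℝ (κ → ℝ) (k • r) * affineReflection N hr 0 := by
  refine AffineEquiv.ext fun x => ?_
  rw [affineEquiv_mul_apply, affineReflection_apply, affineReflection_apply,
    AffineEquiv.constVAdd_apply, vadd_eq_add]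
  module

theorem linearRep_simple (i : κ) : linearRep N (N.toCoxeterSystem.simple i) =
    affineReflection N (geomForm_single_self N i) 0 := by
  refine AffineEquiv.ext fun x => ?_
  rw [linearRep_apply, reflRep_simple', simpleReflection_geom, affineReflection_apply, sub_zero]

/-- If all roots are conjugate to `ρ`, then the linear reflections and one affine reflection of
level `1` with root `ρ` generate the affine reflection group. -/
theorem affineReflectionGroup_le {Γ : Subgroup ((κ → ℝ) ≃ᵃ[ℝ] (κ → ℝ))}
    (h0 : ∀ i, affineReflection N (geomForm_single_self N i) 0 ∈ Γ) {ρ : κ → ℝ}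
    (hρ : geomForm N ρ ρ = 2) (h1 : affineReflection N hρ 1 ∈ Γ) [Nonempty κ]
    (horb : ∀ i, ∃ w, reflRep (geom_isCartan N) w ρ = Pi.single i 1) :
    affineReflectionGroup N ≤ Γ := by
  have lin : ∀ w, linearRep N w ∈ Γ := by
    intro w
    induction w using N.toCoxeterSystem.simple_induction with
    | simple i => rw [linearRep_simple]; exact h0 i
    | one => rw [map_one]; exact Γ.one_mem
    | mul v w hv hw => rw [map_mul]; exact Γ.mul_mem hv hw
  have conj : ∀ w g, g ∈ Γ → linearRep N w * g * (linearRep N w)⁻¹ ∈ Γ := fun w g hg =>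
    Γ.mul_mem (Γ.mul_mem (lin w) hg) (Γ.inv_mem (lin w))
  have orb : ∀ r ∈ roots N, ∃ w, reflRep (geom_isCartan N) w ρ = r := by
    rintro _ ⟨w, i, rfl⟩
    obtain ⟨v, hv⟩ := horb i
    exact ⟨w * v, by rw [map_mul, LinearEquiv.mul_apply, hv]⟩
  have zero : ∀ r (hr : r ∈ roots N), affineReflection N (geomForm_root N hr) 0 ∈ Γ := by
    rintro r hr
    obtain ⟨w, i, h⟩ := id hr
    rw [← linearRep_conj_affineReflection N w (geomForm_single_self N i) _ h.symm]
    exact conj _ _ (h0 i)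
  have hρ' : ρ ∈ roots N := by
    obtain ⟨i⟩ := ‹Nonempty κ›
    obtain ⟨w, hw⟩ := horb i
    refine ⟨w⁻¹, i, ?_⟩
    rw [← hw, ← LinearEquiv.mul_apply, ← map_mul, inv_mul_cancel, map_one]
    rfl
  -- The product of the reflections of levels 1 and 0 in parallel planes is the translation by ρ;
  -- conjugation then yields all root translations.
  have transρ : AffineEquiv.constVAdd ℝ (κ → ℝ) ρ ∈ Γ := by
    have := Γ.mul_mem h1 (Γ.inv_mem (zero ρ hρ'))
    rwa [affineReflection_eq_mul, mul_inv_cancel_right, one_smul] at this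
  have trans : ∀ r ∈ roots N, ∀ k : ℤ, AffineEquiv.constVAdd ℝ (κ → ℝ) ((k : ℝ) • r) ∈ Γ := by
    intro r hr k
    obtain ⟨w, rfl⟩ := orb r hr
    have h := conj w _ transρ
    rw [linearRep_conj_constVAdd] at h
    have h2 := Γ.zpow_mem h k
    have e : AffineEquiv.constVAdd ℝ (κ → ℝ) (reflRep (geom_isCartan N) w ρ) ^ k =
        AffineEquiv.constVAdd ℝ (κ → ℝ) ((k : ℝ) • reflRep (geom_isCartan N) w ρ) := by
      have := map_zpow (AffineEquiv.constVAddHom ℝ (κ → ℝ) (V₁ := κ → ℝ))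
        (Multiplicative.ofAdd (reflRep (geom_isCartan N) w ρ)) k
      rw [← ofAdd_zsmul, ← Int.cast_smul_eq_zsmul ℝ] at this
      exact this.symm
    rwa [e] at h2
  rw [affineReflectionGroup, Subgroup.closure_le]
  intro g hg
  obtain ⟨r, hr, k, rfl⟩ := (isAffineReflection_iff N).mp hg
  rw [affineReflection_eq_mul]
  exact Γ.mul_mem (trans r hr k) (zero r hr)

end generation

theorem exists_range_mulEquiv {G A B : Type*} [Group G] [Group A] [Group B] (f : G →* A)
    (g : G →* B) (h : ∀ x, f x = 1 ↔ g x = 1) :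
    ∃ e : f.range ≃* g.range, ∀ x, e ⟨f x, x, rfl⟩ = ⟨g x, x, rfl⟩ := by
  have hk : f.ker = g.ker := by ext x; exact h x
  refine ⟨((QuotientGroup.quotientKerEquivRange f).symm.trans
    (QuotientGroup.quotientMulEquivOfEq hk)).trans (QuotientGroup.quotientKerEquivRange g), ?_⟩
  intro x
  have e1 : (QuotientGroup.quotientKerEquivRange f).symm ⟨f x, x, rfl⟩ = QuotientGroup.mk x := by
    rw [MulEquiv.symm_apply_eq]; rfl
  rw [MulEquiv.trans_apply, MulEquiv.trans_apply, e1]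
  rfl

section H₃

open Real goldenRatio

theorem goldenRatio_eq : (4 * Real.cos (Real.pi / (5 : ℕ)) ^ 2 : ℝ) = φ + 1 := by
  have : Real.cos (Real.pi / (5 : ℕ)) = (1 + √5) / 4 := by exact_mod_cast Real.cos_pi_div_five
  rw [this, goldenRatio]
  have h5 : √5 ^ 2 = 5 := Real.sq_sqrt (by norm_num)
  linear_combination h5 / 4

theorem geomMatrix_H₃ : geomMatrix CoxeterMatrix.H₃ = !![2, -1, 0; -1, 2, -φ; 0, -φ, 2] := by
  have h3 : Real.cos (Real.pi / (3 : ℕ)) = 1 / 2 := by exact_mod_cast Real.cos_pi_div_three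
  have h2 : Real.cos (Real.pi / (2 : ℕ)) = 0 := by exact_mod_cast Real.cos_pi_div_two
  have h1 : Real.cos (Real.pi / (1 : ℕ)) = -1 := by rw [Nat.cast_one, div_one, Real.cos_pi]
  have h5 : -2 * Real.cos (Real.pi / (5 : ℕ)) = -φ := by
    have : Real.cos (Real.pi / (5 : ℕ)) = (1 + √5) / 4 := by exact_mod_cast Real.cos_pi_div_five
    rw [this, goldenRatio]; ring
  ext i j
  rw [geomMatrix, Matrix.of_apply]
  have e : ∀ {m : ℕ} {c : ℝ}, CoxeterMatrix.H₃ i j = m → -2 * Real.cos (Real.pi / m) = c →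
      -2 * Real.cos (Real.pi / CoxeterMatrix.H₃ i j) = c := by
    rintro m c rfl h; exact h
  fin_cases i <;> fin_cases j
  · exact e (m := 1) rfl (by rw [h1]; simp)
  · exact e (m := 3) rfl (by rw [h3]; simp)
  · exact e (m := 2) rfl (by rw [h2]; simp)
  · exact e (m := 3) rfl (by rw [h3]; simp)
  · exact e (m := 1) rfl (by rw [h1]; simp)
  · exact e (m := 5) rfl h5
  · exact e (m := 2) rfl (by rw [h2]; simp)
  · exact e (m := 5) rfl h5
  · exact e (m := 1) rfl (by rw [h1]; simp)

theorem geomForm_H₃ (x y : Fin 3 → ℝ) : geomForm CoxeterMatrix.H₃ x y =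
    2 * x 0 * y 0 + 2 * x 1 * y 1 + 2 * x 2 * y 2 - x 0 * y 1 - x 1 * y 0
      - φ * (x 1 * y 2 + x 2 * y 1) := by
  rw [geomForm_apply, geomMatrix_H₃]
  simp [Matrix.mulVec, dotProduct, Fin.sum_univ_three]
  ring

/-- The positive root that is orthogonal to the two end nodes of the diagram. -/
def innerRoot : Fin 3 → ℝ := ![φ, 2 * φ, φ + 1]

/-- Explicit chains of simple reflections lead from the inner root to each simple root; `s0`, `s1`,
`s2` give the effect of one reflection on coordinates. -/
theorem exists_innerRoot_conj (i : Fin 3) :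
    ∃ w, reflRep (geom_isCartan CoxeterMatrix.H₃) w innerRoot = Pi.single i 1 := by
  let O : (Fin 3 → ℝ) → Prop := fun v =>
    ∃ w, reflRep (geom_isCartan CoxeterMatrix.H₃) w innerRoot = v
  have step : ∀ {v : Fin 3 → ℝ} (i : Fin 3), O v → O (v -
      geomForm CoxeterMatrix.H₃ v (Pi.single i 1) • (Pi.single i 1 : Fin 3 → ℝ)) := by
    rintro v i ⟨w, rfl⟩
    refine ⟨CoxeterMatrix.H₃.toCoxeterSystem.simple i * w, ?_⟩
    rw [map_mul, LinearEquiv.mul_apply, reflRep_simple', simpleReflection_geom]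
  have s0 : ∀ {a b c : ℝ} (a' : ℝ), a' = b - a → O ![a, b, c] → O ![a', b, c] := by
    rintro a b c _ rfl h
    convert step 0 h using 1
    ext j; fin_cases j <;> simp [geomForm_H₃]
    ring
  have s1 : ∀ {a b c : ℝ} (b' : ℝ), b' = a - b + φ * c → O ![a, b, c] → O ![a, b', c] := by
    rintro a b c _ rfl h
    convert step 1 h using 1
    ext j; fin_cases j <;> simp [geomForm_H₃]
    ring
  have s2 : ∀ {a b c : ℝ} (c' : ℝ), c' = φ * b - c → O ![a, b, c] → O ![a, b, c'] := by
    rintro a b c _ rfl h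
    convert step 2 h using 1
    ext j; fin_cases j <;> simp [geomForm_H₃]
    ring
  have hφ := Real.goldenRatio_sq
  have h0 : O ![φ, 2 * φ, φ + 1] := ⟨1, by rw [map_one]; rfl⟩
  have h1 : O ![φ, φ + 1, φ + 1] := s1 _ (by linear_combination -hφ) h0
  have h2 : O ![1, φ + 1, φ + 1] := s0 _ (by ring) h1
  have h3 : O ![1, φ + 1, φ] := s2 _ (by linear_combination -hφ) h2
  have h4 : O ![1, 1, φ] := s1 _ (by linear_combination -hφ) h3
  have k2 : O ![φ, φ + 1, φ] := s2 _ (by linear_combination -hφ) h1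
  have k3 : O ![φ, φ, φ] := s1 _ (by linear_combination -hφ) k2
  have k4 : O ![0, φ, φ] := s0 _ (by ring) k3
  have k5 : O ![0, φ, 1] := s2 _ (by linear_combination -hφ) k4
  have conclude : ∀ {v : Fin 3 → ℝ} {i : Fin 3}, O v → v = Pi.single i 1 →
      ∃ w, reflRep (geom_isCartan CoxeterMatrix.H₃) w innerRoot = Pi.single i 1 :=
    fun ⟨w, hw⟩ e => ⟨w, hw.trans e⟩
  fin_cases i
  · refine conclude (s1 0 (by ring) (s2 0 (by ring) h4)) ?_
    ext j; fin_cases j <;> rfl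
  · refine conclude (s2 0 (by ring) (s0 0 (by ring) h4)) ?_
    ext j; fin_cases j <;> rfl
  · refine conclude (s1 0 (by ring) k5) ?_
    ext j; fin_cases j <;> rfl

theorem innerRoot_mem_roots : innerRoot ∈ roots CoxeterMatrix.H₃ := by
  obtain ⟨w, hw⟩ := exists_innerRoot_conj 0
  refine ⟨w⁻¹, 0, ?_⟩
  rw [← hw, ← LinearEquiv.mul_apply, ← map_mul, inv_mul_cancel, map_one]
  rfl

/-- The affine realization of the star with labels `5, 5, 3`. -/
def starRealization :
    AffineRealization (starCartan ![φ + 1, 3 - (φ + 1), 1]) CoxeterMatrix.H₃ where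
  -- The centre is the middle node of H₃. The three leaves are mutually orthogonal, and the inner
  -- root has product φ - 1 = 2cos(2π/5) with the centre, which gives the second label 5.
  r := ![Pi.single 1 1, Pi.single 2 1, innerRoot, Pi.single 0 1]
  k := ![0, 0, 1, 0]
  -- Forced by `gram`: φ·φ = φ + 1 and (1 - φ)(φ - 1) = -(3 - (φ + 1)); the scales φ and 1 - φ are
  -- Galois conjugate.
  c := ![1, φ, 1 - φ, 1]
  norm i := by
    fin_cases i
    · exact geomForm_single_self _ _
    · exact geomForm_single_self _ _
    · exact geomForm_root _ innerRoot_mem_roots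
    · exact geomForm_single_self _ _
  c_ne i := by
    have h1 := Real.one_lt_goldenRatio
    fin_cases i
    · exact one_ne_zero
    · exact Real.goldenRatio_ne_zero
    · exact sub_ne_zero.mpr h1.ne
    · exact one_ne_zero
  gram i j := by
    have hφ := Real.goldenRatio_sq
    fin_cases i <;> fin_cases j <;> simp [starCartan, geomForm_H₃, innerRoot]
    all_goals first
      | linear_combination hφ
      | linear_combination -hφ
      | exact Or.inr (by linear_combination -2 * hφ)
      | linear_combination (2 - φ) * hφ
      | linear_combination 4 * φ * (1 - φ) * hφ
      | (simp only [Real.goldenRatio]; ring)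
  sep y h := by
    have h0 := h 0
    have h1 := h 1
    have h3 := h 3
    simp [geomForm_H₃] at h0 h1 h3
    -- Eliminating the end coordinates leaves half the determinant of the H₃ form, nonzero as φ < 2.
    have hy : (2 - φ) * y 1 = 0 := by
      linear_combination 2 * h0 + φ * h1 + h3 + y 1 * Real.goldenRatio_sq
    have h1' : y 1 = 0 := (mul_eq_zero.mp hy).resolve_left
      (sub_ne_zero.mpr Real.goldenRatio_lt_two.ne')
    ext j; fin_cases j
    · change y 0 = 0
      linear_combination (h3 + h1') / 2
    · exact h1'
    · change y 2 = 0
      linear_combination (h1 + φ * h1') / 2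
  indep a h h' := by
    simp [Fin.sum_univ_four] at h'
    -- Only the inner root has nonzero level; the other three vectors are the simple roots.
    have h2 : a 2 = 0 := h'.resolve_right (sub_ne_zero.mpr Real.one_lt_goldenRatio.ne)
    have e0 := congrFun h 0
    have e1 := congrFun h 1
    have e2 := congrFun h 2
    simp [Fin.sum_univ_four, h2] at e0 e1 e2
    have e3 := e2.resolve_right (by positivity)
    ext j; fin_cases j <;> simp_all


end H₃

end IcosahedralAffine

/-! ### The degenerate star with labels 5, 5, 3 over an arbitrary field. -/

section IcosahedralStar

open Polynomial CoxeterSystem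

/-- Relabelling of the index set of an affine realization. -/
def AffineRealization.reindex {ι κ : Type*} [Fintype ι] [Fintype κ] [DecidableEq κ]
    {C C' : Matrix ι ι ℝ} {N : CoxeterMatrix κ} (A : AffineRealization C N) (e : Equiv.Perm ι)
    (h : ∀ i j, C' (e i) (e j) = C i j) : AffineRealization C' N where
  r i := A.r (e.symm i)
  k i := A.k (e.symm i)
  c i := A.c (e.symm i)
  norm i := A.norm _
  c_ne i := A.c_ne _
  gram i j := by
    rw [← A.gram, ← h, Equiv.apply_symm_apply, Equiv.apply_symm_apply]
  sep y hy := A.sep y fun i => by simpa using hy (e i)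
  indep a h1 h2 := by
    rw [← Equiv.sum_comp e] at h1 h2
    have := A.indep (a ∘ e) (by simpa using h1) (by simpa using h2)
    ext i
    simpa using congrFun this (e.symm i)

theorem aeval_vPoly_three_one {K : Type*} [Field K] [CharZero K] : aeval (1 : K) (vPoly 3) = 0 := by
  simp [vPoly_three]

/-- The Cartan matrix of the star as a matrix of polynomials. -/
def starPolynomial (β : Fin 3 → ℤ[X]) : Matrix (Fin 4) (Fin 4) ℤ[X] :=
  !![2, -β 0, -β 1, -β 2;
     -1, 2, 0, 0;
     -1, 0, 2, 0;
     -1, 0, 0, 2]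

theorem starCartan_eq_map {K : Type*} [Field K] {β : Fin 3 → ℤ[X]} {α : Fin 3 → K} {t : K}
    (h : ∀ i, α i = aeval t (β i)) : starCartan α = (starPolynomial β).map (aeval t) := by
  ext i j
  rw [Matrix.map_apply]
  fin_cases i <;> fin_cases j <;> simp [starCartan, starPolynomial, h, map_ofNat]

theorem aeval_starPolynomial_entry {K : Type*} [Field K] (t : K) (i : Fin 3) :
    aeval t ((![X, 3 - X, 1] : Fin 3 → ℤ[X]) i) = (![t, 3 - t, 1] : Fin 3 → K) i := by
  fin_cases i <;> simp [map_ofNat]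

open Real goldenRatio in
theorem exists_mulEquiv_affineReflectionGroup {K : Type*} [Field K] [CharZero K]
    {p : Fin 3 → ℕ} (hp : ∀ i, 3 ≤ p i)
    {α : Fin 3 → K} (hα : ∀ i, aeval (α i) (vPoly (p i)) = 0) (σ : Equiv.Perm (Fin 3))
    (hpσ : p ∘ σ = ![5, 5, 3]) (τ : K) (hασ : α ∘ σ = ![τ, 3 - τ, 1]) :
    ∃ e : reflGroup (star_isCartan hp hα) ≃* affineReflectionGroup CoxeterMatrix.H₃,
      (∀ i, IsAffineReflection CoxeterMatrix.H₃
        (e (gen (star_isCartan hp hα) i) : (Fin 3 → ℝ) ≃ᵃ[ℝ] (Fin 3 → ℝ))) ∧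
      (∀ g : reflGroup (star_isCartan hp hα),
        IsTranslation (star_isCartan hp hα) (g : (Fin 4 → K) ≃ₗ[K] (Fin 4 → K)) ↔
          ∃ v : Fin 3 → ℝ, ∀ x,
            (e g : (Fin 3 → ℝ) ≃ᵃ[ℝ] (Fin 3 → ℝ)) x = x + v) := by
  have hpi : ∀ i, p i = ![5, 5, 3] (σ.symm i) := fun i => by rw [← hpσ]; simp
  have hαi : ∀ i, α i = ![τ, 3 - τ, 1] (σ.symm i) := fun i => by rw [← hασ]; simp
  have e0 : p (σ 0) = 5 := congrFun hpσ 0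
  have e1 : p (σ 1) = 5 := congrFun hpσ 1
  have hτ : aeval τ (vPoly 5) = 0 := by
    have := hα (σ 0)
    rwa [e0, show α (σ 0) = τ from congrFun hασ 0] at this
  have hτ' : aeval (3 - τ) (vPoly 5) = 0 := by
    have := hα (σ 1)
    rwa [e1, show α (σ 1) = 3 - τ from congrFun hασ 1] at this
  have hu : aeval (φ + 1) (vPoly 5) = 0 := by
    rw [← goldenRatio_eq]; exact minpoly.aeval _ _
  -- As τ and 3 - τ are roots of v₅, v₅ divides v₅(3 - X); evaluating at φ + 1 transfers this to ℝ.
  have hu' : aeval (3 - (φ + 1)) (vPoly 5) = 0 := by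
    have h1 : minpoly ℚ τ ∣ (vPoly 5).comp (3 - X) :=
      minpoly.dvd _ _ (by rw [aeval_comp]; simpa [map_ofNat] using hτ')
    rw [minpoly_eq_vPoly hτ, ← minpoly_eq_vPoly hu] at h1
    have := (minpoly.dvd_iff).mp h1
    rw [aeval_comp, minpoly_eq_vPoly hu] at this
    simpa [map_ofNat] using this
  have hs : ∀ f : ℤ[X], aeval τ f = 0 ↔ aeval (φ + 1) f = 0 := by
    intro f
    rw [← aeval_map_algebraMap ℚ, ← aeval_map_algebraMap ℚ (φ + 1), ← minpoly.dvd_iff,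
      ← minpoly.dvd_iff, minpoly_eq_vPoly hτ, minpoly_eq_vPoly hu]
  let α' : Fin 3 → ℝ := ![φ + 1, 3 - (φ + 1), 1] ∘ σ.symm
  have hα' : ∀ i, aeval (α' i) (vPoly (p i)) = 0 := by
    intro i
    rw [hpi]
    simp only [α', Function.comp_apply]
    generalize σ.symm i = j
    fin_cases j
    · exact hu
    · exact hu'
    · exact aeval_vPoly_three_one
  let β : Fin 3 → ℤ[X] := ![X, 3 - X, 1] ∘ σ.symm
  have hC : starCartan α = (starPolynomial β).map (aeval τ) :=
    starCartan_eq_map fun i => by rw [hαi]; exact (aeval_starPolynomial_entry τ _).symm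
  have hC' : starCartan α' = (starPolynomial β).map (aeval (φ + 1)) :=
    starCartan_eq_map fun i => by exact (aeval_starPolynomial_entry _ _).symm
  set h := star_isCartan hp hα
  set h' := star_isCartan hp hα'
  let A : AffineRealization (starCartan α') CoxeterMatrix.H₃ :=
    starRealization.reindex (starPerm σ) fun i j => by
      rw [starCartan_starPerm]
      congr 1
      ext i; simp [α']
  -- The linear group over K and the affine group are quotients of the same Coxeter group by the
  -- same kernel.
  have hk : ∀ w, reflRep h w = 1 ↔ A.rep h' w = 1 := fun w =>
    (reflRep_eq_one_congr hs hC hC' h h' w).trans (A.reflRep_eq_one_iff h' w)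
  have ht : ∀ w, IsTranslation h (reflRep h w) ↔ ∃ v, ∀ x, A.rep h' w x = x + v := fun w =>
    (isTranslation_congr hs hC hC' h h' w).trans (A.isTranslation_iff h' w)
  have hrefl : ∀ i, A.refl (starPerm σ i) = starRealization.refl i := by
    intro i
    refine AffineEquiv.ext fun x => ?_
    simp only [AffineRealization.refl, affineReflection_apply, A, AffineRealization.reindex,
      Equiv.symm_apply_apply]
  have hroot : ∀ i, IsAffineReflection CoxeterMatrix.H₃ (starRealization.refl i) := by
    have simple : ∀ i, Pi.single i 1 ∈ roots CoxeterMatrix.H₃ :=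
      fun i => ⟨1, i, by rw [map_one]; rfl⟩
    intro i
    rw [isAffineReflection_iff]
    fin_cases i
    · exact ⟨_, simple 1, 0, by rw [Int.cast_zero]; rfl⟩
    · exact ⟨_, simple 2, 0, by rw [Int.cast_zero]; rfl⟩
    · exact ⟨_, innerRoot_mem_roots, 1, by rw [Int.cast_one]; rfl⟩
    · exact ⟨_, simple 0, 0, by rw [Int.cast_zero]; rfl⟩
  have hroot' : ∀ i, IsAffineReflection CoxeterMatrix.H₃ (A.refl i) := by
    intro i
    obtain ⟨j, rfl⟩ := (starPerm σ).surjective i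
    rw [hrefl]
    exact hroot j
  have hmem : ∀ i, starRealization.refl i ∈ (A.rep h').range := fun i =>
    ⟨_, (A.rep_simple h' (starPerm σ i)).trans (hrefl i)⟩
  have hrange : (A.rep h').range = affineReflectionGroup CoxeterMatrix.H₃ := by
    apply le_antisymm
    · rintro _ ⟨w, rfl⟩
      induction w using (starCoxeter p hp).toCoxeterSystem.simple_induction with
      | simple i =>
        rw [A.rep_simple]
        exact Subgroup.subset_closure (hroot' i)
      | one => rw [map_one]; exact Subgroup.one_mem _
      | mul v w hv hw => rw [map_mul]; exact Subgroup.mul_mem _ hv hw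
    -- Star nodes 3, 0, 1 carry the simple roots 0, 1, 2 at level 0, and node 2 the inner root at
    -- level 1.
    · refine affineReflectionGroup_le _ ?_ (geomForm_root _ innerRoot_mem_roots) (hmem 2)
        exists_innerRoot_conj
      intro i
      fin_cases i
      · exact hmem 3
      · exact hmem 0
      · exact hmem 1
  obtain ⟨e, he⟩ : ∃ e : reflGroup h ≃* (A.rep h').range,
      ∀ w, e ⟨reflRep h w, w, rfl⟩ = ⟨A.rep h' w, w, rfl⟩ :=
    exists_range_mulEquiv (reflRep h) (A.rep h') hk
  refine ⟨e.trans (MulEquiv.subgroupCongr hrange), ?_, ?_⟩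
  · intro i
    have e1 : gen h i = ⟨reflRep h ((starCoxeter p hp).toCoxeterSystem.simple i), _, rfl⟩ :=
      Subtype.ext (reflRep_simple' h i).symm
    have e2 : ((e.trans (MulEquiv.subgroupCongr hrange)) (gen h i) :
        (Fin 3 → ℝ) ≃ᵃ[ℝ] (Fin 3 → ℝ)) = A.refl i := by
      rw [e1, ← A.rep_simple h' i]
      exact congrArg Subtype.val (he _)
    rw [e2]
    exact hroot' i
  · rintro ⟨_, w, rfl⟩
    rw [ht w]
    have e2 : ((e.trans (MulEquiv.subgroupCongr hrange)) ⟨reflRep h w, w, rfl⟩ :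
        (Fin 3 → ℝ) ≃ᵃ[ℝ] (Fin 3 → ℝ)) = A.rep h' w :=
      congrArg Subtype.val (he _)
    rw [e2]

end IcosahedralStar

end ReflRep

end

open ReflRep Polynomial in
theorem mainTheorem8 {K : Type*} [Field K] [CharZero K]
    (p : Fin 3 → ℕ) (hp : ∀ i, 3 ≤ p i)
    (α : Fin 3 → K) (hα : ∀ i, aeval (α i) (vPoly (p i)) = 0) :
    -- the path
    ((discr (path_isCartan hp hα) = 0 ↔ p = ![4, 3, 4] ∧ α = ![2, 1, 2]) ∧
      (discr (path_isCartan hp hα) = 0 →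
        Module.finrank K (fixedSpace (path_isCartan hp hα)) = 1 ∧
        fixedSpace (path_isCartan hp hα) = Submodule.span K {![1, 1, 1, 1 / 2]} ∧
        ∃ cs : CoxeterSystem affineC₃ (reflGroup (path_isCartan hp hα)),
          ∀ i, cs.simple i = gen (path_isCartan hp hα) i)) ∧
    -- the star
    ((discr (star_isCartan hp hα) = 0 ↔
        ∃ σ : Equiv.Perm (Fin 3),
          (p ∘ σ = ![3, 3, 4] ∧ α ∘ σ = ![1, 1, 2]) ∨
          (p ∘ σ = ![5, 5, 3] ∧ ∃ τ : K, τ ^ 2 - 3 * τ + 1 = 0 ∧ α ∘ σ = ![τ, 3 - τ, 1])) ∧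
      (discr (star_isCartan hp hα) = 0 →
        Module.finrank K (fixedSpace (star_isCartan hp hα)) = 1 ∧
        fixedSpace (star_isCartan hp hα) = Submodule.span K {![1, 1 / 2, 1 / 2, 1 / 2]}) ∧
      (∀ σ : Equiv.Perm (Fin 3), p ∘ σ = ![3, 3, 4] → α ∘ σ = ![1, 1, 2] →
        ∃ cs : CoxeterSystem affineB₃ (reflGroup (star_isCartan hp hα)),
          cs.simple 0 = gen (star_isCartan hp hα) 0 ∧
          ∀ k : Fin 3, cs.simple k.succ = gen (star_isCartan hp hα) (σ k).succ) ∧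
      (∀ σ : Equiv.Perm (Fin 3), p ∘ σ = ![5, 5, 3] →
        ∀ τ : K, τ ^ 2 - 3 * τ + 1 = 0 → α ∘ σ = ![τ, 3 - τ, 1] →
        ∃ e : reflGroup (star_isCartan hp hα) ≃* affineReflectionGroup CoxeterMatrix.H₃,
          (∀ i, IsAffineReflection CoxeterMatrix.H₃
            (e (gen (star_isCartan hp hα) i) : (Fin 3 → ℝ) ≃ᵃ[ℝ] (Fin 3 → ℝ))) ∧
          (∀ g : reflGroup (star_isCartan hp hα),
            IsTranslation (star_isCartan hp hα) (g : (Fin 4 → K) ≃ₗ[K] (Fin 4 → K)) ↔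
              ∃ v : Fin 3 → ℝ, ∀ x,
                (e g : (Fin 3 → ℝ) ≃ᵃ[ℝ] (Fin 3 → ℝ)) x = x + v))) := by
  refine ⟨⟨discr_path_eq_zero_iff hp hα, fun h => ?_⟩, discr_star_eq_zero_iff hp hα,
    fun h => ?_, exists_coxeterSystem_star hp hα,
    fun σ hpσ τ _ hασ => exists_mulEquiv_affineReflectionGroup hp hα σ hpσ τ hασ⟩
  · have hf := fixedSpace_path hp hα h
    obtain ⟨hpe, hαe⟩ := (discr_path_eq_zero_iff hp hα).mp h
    exact ⟨hf ▸ finrank_span_fun (i := 0) rfl, hf, exists_coxeterSystem_path hp hα hpe hαe⟩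
  · have hf := fixedSpace_star hp hα h
    exact ⟨hf ▸ finrank_span_fun (i := 0) rfl, hf⟩
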